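/- **Conventions.** A double category $\mathbb D$ is a pseudo double category: $\mathbb D_0$ is its category of objects and arrows, $\mathbb D_1$ its category of proarrows $m\colon A\nrightarrow B$ and cells, $y\colon\mathbb D_0\to\mathbb D_1$ the external unit functor, and $\otimes$ the external composition, in diagrammatic order. A cell $\theta\colon m\Rightarrow n$ has a source arrow and a target arrow; it is *globular* if both are identities, and $\mathbb D(A,B)$ is the category of proarrows $A\nrightarrow B$ and globular cells. A *restriction* (*extension*) is a cell that is a cartesian (opcartesian) arrow for $\langle \mathrm{src},\mathrm{tgt}\rangle\colon\mathbb D_1\to\mathbb D_0\times\mathbb D_0$. * $\mathbb D$ is *unit-pure* if $y$ is full. It is *cartesian* if $\mathbb D\to\mathbb D\times\mathbb D$ and $\mathbb D\to\mathbf 1$ have right adjoints in the 2-category of double categories, pseudo double functors and vertical transformations. It is an *equipment* if every arrow $f\colon A\to B$ has a companion $f_!\colon A\nrightarrow B$ and a conjoint $f^*\colon B\nrightarrow A$. * An arrow $e\colon A\to E$ is a *cover* if, for the extension $y_A\Rightarrow e^*\otimes e_!$ along $(e,e)$, the canonical globular cell $e^*\otimes e_!\Rightarrow y_E$ is invertible.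 An arrow $i\colon E\to B$ is an *inclusion* if, for the restriction $i_!\otimes i^*\Rightarrow y_B$ along $(i,i)$, the canonical globular cell $y_E\Rightarrow i_!\otimes i^*$ is invertible. A *relation* is a span $A\xleftarrow{l}R\xrightarrow{r}B$ in $\mathbb D_0$ such that $\langle l,r\rangle\colon R\to A\times B$ is an inclusion. * *Tabulators exist* if $y$ has a right adjoint $\top\colon\mathbb D_1\to\mathbb D_0$; the tabulator of $m\colon A\nrightarrow B$ is $\top m$ with the counit cell $\tau_m\colon y_{\top m}\Rightarrow m$, and its legs $l\colon\top m\to A$, $r\colon\top m\to B$ are the source and target of $\tau_m$. Tabulators are *strong* if every $\tau_m$ is an extension (so $m\cong l^*\otimes r_!$), and *discrete* if the legs of every tabulator form a relation. They are *functorial* if the following holds for all $p\colon A\nrightarrow B$ and $q\colon B\nrightarrow E$: whenever $\top p\times_B\top q\to I\to A\times E$ factors the morphism induced by the outer legs as a cover followed by an inclusion, the induced morphism $I\to\top(p\otimes q)$ over $A\times E$ is invertible. * *Local products satisfy Frobenius* if, for every $f\colon A\to B$, $r\colon B\nrightarrow X$ and $q\colon A\nrightarrow X$, there is an isomorphism $r\wedge(f^*\otimes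 q)\cong f^*\otimes((f_!\otimes r)\wedge q)$ in $\mathbb D(B,X)$, where $\wedge$ denotes binary products in the categories $\mathbb D(-,-)$. * For a finitely complete category $\mathscr C$ with a proper ($\mathcal E$ consists of epimorphisms and $\mathcal M$ of monomorphisms) and stable ($\mathcal E$ is closed under pullback) orthogonal factorization system $\mathcal F=(\mathcal E,\mathcal M)$, the double category $\mathbb R\mathbf{el}(\mathscr C;\mathcal F)$ has the objects and arrows of $\mathscr C$. Its proarrows $A\nrightarrow B$ are the spans $A\leftarrow R\to B$ with $R\to A\times B$ in $\mathcal M$, and its cells are the morphisms of spans. Its external units are the diagonals, and external composition is the pullback followed by the $\mathcal M$-part of the $(\mathcal E,\mathcal M)$-factorization. **Theorem.** Let $\mathbb D$ be a unit-pure cartesian equipment such that 1. tabulators exist and are strong, discrete and functorial; 2. every relation is a tabulator, that is, every relation $A\xleftarrow{l}R\xrightarrow{r}B$ consists of the legs of a tabulator of some proarrow $A\nrightarrow B$; 3. local products satisfy Frobenius. Then $\mathbb D_0$ has finite limits; the covers and the inclusions are the left and right classes of a proper and stable orthogonal factorization system $\mathcal F$ on $\mathbb D_0$; and the identity functor on $\mathbb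 D_0$ extends to an adjoint equivalence of double categories $$\mathbb R\mathbf{el}(\mathbb D_0;\mathcal F)\simeq\mathbb D .$$ That is, there are pseudo double functors in both directions that are the identity on $\mathbb D_0$, with invertible vertical transformations as unit and counit that are the identity on $\mathbb D_0$ and satisfy the triangle identities. -/

import Mathlib

open CategoryTheory CategoryTheory.Limits

set_option linter.checkUnivs false

attribute [-instance] CategoryTheory.catToReflQuiver

universe w z v u w' z' v' u' w'' z'' v'' u''

/-- The proarrows of a family `Pro`, bundled with their external source and target. -/
structure ProTotal {C : Type u} (Pro : C → C → Type w) where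
  of ::
  {src : C}
  {tgt : C}
  pro : Pro src tgt

/-- A pseudo double category whose category of objects and arrows is `C`.
A cell is a morphism in the category of all proarrows; its vertical boundary is `(sMap, tMap)`.
External composition is written in diagrammatic order. -/
structure DoubleCat (C : Type u) [Category.{v} C] where
  /-- proarrows -/
  Pro : C → C → Type w
  /-- the category of proarrows and cells -/
  [cat : Category.{z} (ProTotal Pro)]
  /-- external source of a cell -/
  sMap {A B A' B' : C} {m : Pro A B} {m' : Pro A' B'}
    (α : ProTotal.of m ⟶ ProTotal.of m') : A ⟶ A'
  /-- external target of a cell -/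
  tMap {A B A' B' : C} {m : Pro A B} {m' : Pro A' B'}
    (α : ProTotal.of m ⟶ ProTotal.of m') : B ⟶ B'
  sMap_id {A B : C} (m : Pro A B) : sMap (𝟙 (ProTotal.of m)) = 𝟙 A
  tMap_id {A B : C} (m : Pro A B) : tMap (𝟙 (ProTotal.of m)) = 𝟙 B
  sMap_comp {A B A' B' A'' B'' : C} {m : Pro A B} {m' : Pro A' B'} {m'' : Pro A'' B''}
    (α : ProTotal.of m ⟶ ProTotal.of m') (β : ProTotal.of m' ⟶ ProTotal.of m'') :
    sMap (α ≫ β) = sMap α ≫ sMap β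
  tMap_comp {A B A' B' A'' B'' : C} {m : Pro A B} {m' : Pro A' B'} {m'' : Pro A'' B''}
    (α : ProTotal.of m ⟶ ProTotal.of m') (β : ProTotal.of m' ⟶ ProTotal.of m'') :
    tMap (α ≫ β) = tMap α ≫ tMap β
  /-- external unit proarrow -/
  y (A : C) : Pro A A
  /-- external unit cell of an arrow -/
  yMap {A B : C} (f : A ⟶ B) : ProTotal.of (y A) ⟶ ProTotal.of (y B)
  sMap_yMap {A B : C} (f : A ⟶ B) : sMap (yMap f) = f
  tMap_yMap {A B : C} (f : A ⟶ B) : tMap (yMap f) = f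
  yMap_id (A : C) : yMap (𝟙 A) = 𝟙 (ProTotal.of (y A))
  yMap_comp {A B E : C} (f : A ⟶ B) (g : B ⟶ E) : yMap (f ≫ g) = yMap f ≫ yMap g
  /-- external composition of proarrows -/
  tens {A B E : C} (m : Pro A B) (n : Pro B E) : Pro A E
  /-- external composition of cells that agree on the common vertical boundary -/
  tensMap {A B E A' B' E' : C} {m : Pro A B} {n : Pro B E} {m' : Pro A' B'} {n' : Pro B' E'}
    (α : ProTotal.of m ⟶ ProTotal.of m') (β : ProTotal.of n ⟶ ProTotal.of n')
    (h : tMap α = sMap β) : ProTotal.of (tens m n) ⟶ ProTotal.of (tens m' n')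
  sMap_tensMap {A B E A' B' E' : C} {m : Pro A B} {n : Pro B E} {m' : Pro A' B'} {n' : Pro B' E'}
    (α : ProTotal.of m ⟶ ProTotal.of m') (β : ProTotal.of n ⟶ ProTotal.of n')
    (h : tMap α = sMap β) : sMap (tensMap α β h) = sMap α
  tMap_tensMap {A B E A' B' E' : C} {m : Pro A B} {n : Pro B E} {m' : Pro A' B'} {n' : Pro B' E'}
    (α : ProTotal.of m ⟶ ProTotal.of m') (β : ProTotal.of n ⟶ ProTotal.of n')
    (h : tMap α = sMap β) : tMap (tensMap α β h) = tMap β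
  tensMap_id {A B E : C} (m : Pro A B) (n : Pro B E) :
    tensMap (𝟙 (ProTotal.of m)) (𝟙 (ProTotal.of n)) ((tMap_id _).trans (sMap_id _).symm) =
      𝟙 (ProTotal.of (tens m n))
  tensMap_comp {A B E A' B' E' A'' B'' E'' : C} {m : Pro A B} {n : Pro B E}
    {m' : Pro A' B'} {n' : Pro B' E'} {m'' : Pro A'' B''} {n'' : Pro B'' E''}
    (α : ProTotal.of m ⟶ ProTotal.of m') (β : ProTotal.of n ⟶ ProTotal.of n')
    (α' : ProTotal.of m' ⟶ ProTotal.of m'') (β' : ProTotal.of n' ⟶ ProTotal.of n'')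
    (h : tMap α = sMap β) (h' : tMap α' = sMap β') :
    tensMap (α ≫ α') (β ≫ β') (by rw [tMap_comp, sMap_comp, h, h']) =
      tensMap α β h ≫ tensMap α' β' h'
  /-- associator -/
  assoc {A B E G : C} (m : Pro A B) (n : Pro B E) (p : Pro E G) :
    ProTotal.of (tens (tens m n) p) ≅ ProTotal.of (tens m (tens n p))
  sMap_assoc {A B E G : C} (m : Pro A B) (n : Pro B E) (p : Pro E G) :
    sMap (assoc m n p).hom = 𝟙 A
  tMap_assoc {A B E G : C} (m : Pro A B) (n : Pro B E) (p : Pro E G) :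
    tMap (assoc m n p).hom = 𝟙 G
  assoc_naturality {A B E G A' B' E' G' : C} {m : Pro A B} {n : Pro B E} {p : Pro E G}
    {m' : Pro A' B'} {n' : Pro B' E'} {p' : Pro E' G'}
    (α : ProTotal.of m ⟶ ProTotal.of m') (β : ProTotal.of n ⟶ ProTotal.of n')
    (γ : ProTotal.of p ⟶ ProTotal.of p') (h : tMap α = sMap β) (h' : tMap β = sMap γ) :
    tensMap (tensMap α β h) γ ((tMap_tensMap α β h).trans h') ≫ (assoc m' n' p').hom =
      (assoc m n p).hom ≫ tensMap α (tensMap β γ h') (h.trans (sMap_tensMap β γ h').symm)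
  /-- left unitor -/
  lam {A B : C} (m : Pro A B) : ProTotal.of (tens (y A) m) ≅ ProTotal.of m
  sMap_lam {A B : C} (m : Pro A B) : sMap (lam m).hom = 𝟙 A
  tMap_lam {A B : C} (m : Pro A B) : tMap (lam m).hom = 𝟙 B
  lam_naturality {A B A' B' : C} {m : Pro A B} {m' : Pro A' B'}
    (α : ProTotal.of m ⟶ ProTotal.of m') :
    tensMap (yMap (sMap α)) α (tMap_yMap _) ≫ (lam m').hom = (lam m).hom ≫ α
  /-- right unitor -/
  rho {A B : C} (m : Pro A B) : ProTotal.of (tens m (y B)) ≅ ProTotal.of m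
  sMap_rho {A B : C} (m : Pro A B) : sMap (rho m).hom = 𝟙 A
  tMap_rho {A B : C} (m : Pro A B) : tMap (rho m).hom = 𝟙 B
  rho_naturality {A B A' B' : C} {m : Pro A B} {m' : Pro A' B'}
    (α : ProTotal.of m ⟶ ProTotal.of m') :
    tensMap α (yMap (tMap α)) (sMap_yMap _).symm ≫ (rho m').hom = (rho m).hom ≫ α
  pentagon {A B E G H : C} (m : Pro A B) (n : Pro B E) (p : Pro E G) (q : Pro G H) :
    tensMap (assoc m n p).hom (𝟙 (ProTotal.of q)) ((tMap_assoc m n p).trans (sMap_id _).symm) ≫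
        (assoc m (tens n p) q).hom ≫
        tensMap (𝟙 (ProTotal.of m)) (assoc n p q).hom ((tMap_id _).trans (sMap_assoc n p q).symm) =
      (assoc (tens m n) p q).hom ≫ (assoc m n (tens p q)).hom
  triangle {A B E : C} (m : Pro A B) (n : Pro B E) :
    (assoc m (y B) n).hom ≫
        tensMap (𝟙 (ProTotal.of m)) (lam n).hom ((tMap_id _).trans (sMap_lam n).symm) =
      tensMap (rho m).hom (𝟙 (ProTotal.of n)) ((tMap_rho m).trans (sMap_id _).symm)

attribute [instance] DoubleCat.cat
attribute [simp] DoubleCat.sMap_id DoubleCat.tMap_id DoubleCat.sMap_comp DoubleCat.tMap_comp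
attribute [simp] DoubleCat.sMap_yMap DoubleCat.tMap_yMap DoubleCat.sMap_tensMap
attribute [simp] DoubleCat.tMap_tensMap DoubleCat.sMap_assoc DoubleCat.tMap_assoc
attribute [simp] DoubleCat.sMap_lam DoubleCat.tMap_lam DoubleCat.sMap_rho DoubleCat.tMap_rho

namespace DoubleCat

variable {C : Type u} [Category.{v} C]

/-- The external unit functor from objects and arrows to proarrows and cells. -/
def unitFunctor (D : DoubleCat.{w, z} C) : C ⥤ ProTotal D.Pro where
  obj A := ProTotal.of (D.y A)
  map f := D.yMap f
  map_id := D.yMap_id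
  map_comp := D.yMap_comp

lemma tensMap_comp_id (D : DoubleCat.{w, z} C) {A B E A' A'' B' : C} {m : D.Pro A B}
    {n : D.Pro B' E} {m' : D.Pro A' B'} {m'' : D.Pro A'' B'} {k : D.Pro B E}
    (α : ProTotal.of m ⟶ ProTotal.of m') (α' : ProTotal.of m' ⟶ ProTotal.of m'')
    (β : ProTotal.of k ⟶ ProTotal.of n)
    (h : D.tMap (α ≫ α') = D.sMap β) (h' : D.tMap α' = 𝟙 B') :
    D.tensMap (α ≫ α') β h =
      D.tensMap α β (by simpa [h'] using h) ≫
        D.tensMap α' (𝟙 (ProTotal.of n)) (by simpa using h') := by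
  rw [← D.tensMap_comp]
  congr 1
  exact (Category.comp_id _).symm

lemma tensMap_id_comp (D : DoubleCat.{w, z} C) {A B E B' E' E'' : C} {m : D.Pro A B}
    {k : D.Pro A B'} {n : D.Pro B E} {n' : D.Pro B' E'} {n'' : D.Pro B' E''}
    (α : ProTotal.of m ⟶ ProTotal.of k)
    (β : ProTotal.of n ⟶ ProTotal.of n') (β' : ProTotal.of n' ⟶ ProTotal.of n'')
    (h : D.tMap α = D.sMap (β ≫ β')) (h' : D.sMap β' = 𝟙 B') :
    D.tensMap α (β ≫ β') h =
      D.tensMap α β (by simpa [h'] using h) ≫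
        D.tensMap (𝟙 (ProTotal.of k)) β' (by simpa using h'.symm) := by
  rw [← D.tensMap_comp]
  congr 1
  exact (Category.comp_id _).symm

/-- The double category is unit-pure: the external unit functor is full. -/
def IsUnitPure (D : DoubleCat.{w, z} C) : Prop := D.unitFunctor.Full

end DoubleCat

/-! ### Double functors, vertical transformations, adjunctions -/

/-- A pseudo double functor extending the ordinary functor `F₀`. -/
structure DoubleFunctor {C : Type u} [Category.{v} C] {C' : Type u'} [Category.{v'} C']
    (F₀ : C ⥤ C') (D : DoubleCat.{w, z} C) (D' : DoubleCat.{w', z'} C') where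
  obj {A B : C} (m : D.Pro A B) : D'.Pro (F₀.obj A) (F₀.obj B)
  map {A B A' B' : C} {m : D.Pro A B} {n : D.Pro A' B'} (α : ProTotal.of m ⟶ ProTotal.of n) :
    ProTotal.of (obj m) ⟶ ProTotal.of (obj n)
  sMap_map {A B A' B' : C} {m : D.Pro A B} {n : D.Pro A' B'}
    (α : ProTotal.of m ⟶ ProTotal.of n) : D'.sMap (map α) = F₀.map (D.sMap α)
  tMap_map {A B A' B' : C} {m : D.Pro A B} {n : D.Pro A' B'}
    (α : ProTotal.of m ⟶ ProTotal.of n) : D'.tMap (map α) = F₀.map (D.tMap α)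
  map_id {A B : C} (m : D.Pro A B) : map (𝟙 (ProTotal.of m)) = 𝟙 (ProTotal.of (obj m))
  map_comp {A B A' B' A'' B'' : C} {m : D.Pro A B} {n : D.Pro A' B'} {p : D.Pro A'' B''}
    (α : ProTotal.of m ⟶ ProTotal.of n) (β : ProTotal.of n ⟶ ProTotal.of p) :
    map (α ≫ β) = map α ≫ map β
  /-- comparison for external composition -/
  mu {A B E : C} (m : D.Pro A B) (n : D.Pro B E) :
    ProTotal.of (D'.tens (obj m) (obj n)) ≅ ProTotal.of (obj (D.tens m n))
  sMap_mu {A B E : C} (m : D.Pro A B) (n : D.Pro B E) :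
    D'.sMap (mu m n).hom = 𝟙 (F₀.obj A)
  tMap_mu {A B E : C} (m : D.Pro A B) (n : D.Pro B E) :
    D'.tMap (mu m n).hom = 𝟙 (F₀.obj E)
  mu_naturality {A B E A' B' E' : C} {m : D.Pro A B} {n : D.Pro B E}
    {m' : D.Pro A' B'} {n' : D.Pro B' E'}
    (α : ProTotal.of m ⟶ ProTotal.of m') (β : ProTotal.of n ⟶ ProTotal.of n')
    (h : D.tMap α = D.sMap β) :
    D'.tensMap (map α) (map β) (by rw [tMap_map, sMap_map, h]) ≫ (mu m' n').hom =
      (mu m n).hom ≫ map (D.tensMap α β h)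
  /-- comparison for external units -/
  unit (A : C) : ProTotal.of (D'.y (F₀.obj A)) ≅ ProTotal.of (obj (D.y A))
  sMap_unit (A : C) : D'.sMap (unit A).hom = 𝟙 (F₀.obj A)
  tMap_unit (A : C) : D'.tMap (unit A).hom = 𝟙 (F₀.obj A)
  unit_naturality {A B : C} (f : A ⟶ B) :
    D'.yMap (F₀.map f) ≫ (unit B).hom = (unit A).hom ≫ map (D.yMap f)
  map_assoc {A B E G : C} (m : D.Pro A B) (n : D.Pro B E) (p : D.Pro E G) :
    D'.tensMap (mu m n).hom (𝟙 (ProTotal.of (obj p)))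
        ((tMap_mu m n).trans (D'.sMap_id _).symm) ≫
        (mu (D.tens m n) p).hom ≫ map (D.assoc m n p).hom =
      (D'.assoc (obj m) (obj n) (obj p)).hom ≫
        D'.tensMap (𝟙 (ProTotal.of (obj m))) (mu n p).hom
          ((D'.tMap_id _).trans (sMap_mu n p).symm) ≫
        (mu m (D.tens n p)).hom
  map_lam {A B : C} (m : D.Pro A B) :
    D'.tensMap (unit A).hom (𝟙 (ProTotal.of (obj m)))
        ((tMap_unit A).trans (D'.sMap_id _).symm) ≫
        (mu (D.y A) m).hom ≫ map (D.lam m).hom = (D'.lam (obj m)).hom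
  map_rho {A B : C} (m : D.Pro A B) :
    D'.tensMap (𝟙 (ProTotal.of (obj m))) (unit B).hom
        ((D'.tMap_id _).trans (sMap_unit B).symm) ≫
        (mu m (D.y B)).hom ≫ map (D.rho m).hom = (D'.rho (obj m)).hom

attribute [simp] DoubleFunctor.sMap_map DoubleFunctor.tMap_map DoubleFunctor.map_id
attribute [simp] DoubleFunctor.sMap_mu DoubleFunctor.tMap_mu
attribute [simp] DoubleFunctor.sMap_unit DoubleFunctor.tMap_unit

namespace DoubleFunctor

variable {C : Type u} [Category.{v} C] {C' : Type u'} [Category.{v'} C']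
  {C'' : Type u''} [Category.{v''} C'']

/-- The image of an isomorphism of proarrows under a double functor. -/
def mapIso {F₀ : C ⥤ C'} {D : DoubleCat.{w, z} C} {D' : DoubleCat.{w', z'} C'}
    (F : DoubleFunctor F₀ D D') {A B A' B' : C} {m : D.Pro A B} {n : D.Pro A' B'}
    (i : ProTotal.of m ≅ ProTotal.of n) : ProTotal.of (F.obj m) ≅ ProTotal.of (F.obj n) where
  hom := F.map i.hom
  inv := F.map i.inv
  hom_inv_id := by rw [← F.map_comp, i.hom_inv_id, F.map_id]
  inv_hom_id := by rw [← F.map_comp, i.inv_hom_id, F.map_id]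

lemma mu_naturality_left {F₀ : C ⥤ C'} {D : DoubleCat.{w, z} C} {D' : DoubleCat.{w', z'} C'}
    (F : DoubleFunctor F₀ D D') {A B E A' : C} {m : D.Pro A B} {m' : D.Pro A' B}
    (n : D.Pro B E) (α : ProTotal.of m ⟶ ProTotal.of m') (h : D.tMap α = 𝟙 B) :
    D'.tensMap (F.map α) (𝟙 (ProTotal.of (F.obj n))) (by simp [h]) ≫ (F.mu m' n).hom =
      (F.mu m n).hom ≫ F.map (D.tensMap α (𝟙 (ProTotal.of n)) (by simp [h])) := by
  rw [← F.mu_naturality]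
  congr 2
  exact (F.map_id n).symm

lemma mu_naturality_right {F₀ : C ⥤ C'} {D : DoubleCat.{w, z} C} {D' : DoubleCat.{w', z'} C'}
    (F : DoubleFunctor F₀ D D') {A B E E' : C} (m : D.Pro A B) {n : D.Pro B E} {n' : D.Pro B E'}
    (β : ProTotal.of n ⟶ ProTotal.of n') (h : D.sMap β = 𝟙 B) :
    D'.tensMap (𝟙 (ProTotal.of (F.obj m))) (F.map β) (by simp [h]) ≫ (F.mu m n').hom =
      (F.mu m n).hom ≫ F.map (D.tensMap (𝟙 (ProTotal.of m)) β (by simp [h])) := by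
  rw [← F.mu_naturality]
  congr 2
  exact (F.map_id m).symm

/-- The identity double functor. -/
def id (D : DoubleCat.{w, z} C) : DoubleFunctor (𝟭 C) D D where
  obj m := m
  map α := α
  sMap_map _ := rfl
  tMap_map _ := rfl
  map_id _ := rfl
  map_comp _ _ := rfl
  mu _ _ := Iso.refl _
  sMap_mu _ _ := D.sMap_id _
  tMap_mu _ _ := D.tMap_id _
  mu_naturality α β h := by
    simp only [Iso.refl_hom]
    exact (Category.comp_id _).trans (Category.id_comp _).symm
  unit _ := Iso.refl _
  sMap_unit _ := D.sMap_id _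
  tMap_unit _ := D.tMap_id _
  unit_naturality f := (Category.comp_id _).trans (Category.id_comp _).symm
  map_assoc m n p := by
    simp only [Iso.refl_hom]
    erw [D.tensMap_id, D.tensMap_id, Category.id_comp, Category.id_comp, Category.id_comp,
      Category.comp_id]
  map_lam m := by
    simp only [Iso.refl_hom]
    erw [D.tensMap_id, Category.id_comp, Category.id_comp]
  map_rho m := by
    simp only [Iso.refl_hom]
    erw [D.tensMap_id, Category.id_comp, Category.id_comp]

/-- Composition of double functors. -/
def comp {F₀ : C ⥤ C'} {G₀ : C' ⥤ C''} {D : DoubleCat.{w, z} C} {D' : DoubleCat.{w', z'} C'}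
    {D'' : DoubleCat.{w'', z''} C''} (F : DoubleFunctor F₀ D D') (G : DoubleFunctor G₀ D' D'') :
    DoubleFunctor (F₀ ⋙ G₀) D D'' where
  obj m := G.obj (F.obj m)
  map α := G.map (F.map α)
  sMap_map α := by rw [G.sMap_map, F.sMap_map]; rfl
  tMap_map α := by rw [G.tMap_map, F.tMap_map]; rfl
  map_id m := by rw [F.map_id, G.map_id]
  map_comp α β := by rw [F.map_comp, G.map_comp]
  mu m n := (G.mu (F.obj m) (F.obj n)).trans (G.mapIso (F.mu m n))
  sMap_mu m n := by
    simp [mapIso]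
  tMap_mu m n := by
    simp [mapIso]
  mu_naturality α β h := by
    simp only [Iso.trans_hom, mapIso, Category.assoc]
    rw [← G.map_comp, ← F.mu_naturality, G.map_comp, ← Category.assoc, G.mu_naturality,
      Category.assoc]
  unit A := (G.unit (F₀.obj A)).trans (G.mapIso (F.unit A))
  sMap_unit A := by
    simp [mapIso]
  tMap_unit A := by
    simp [mapIso]
  unit_naturality f := by
    simp only [Iso.trans_hom, mapIso, Category.assoc]
    rw [← G.map_comp, ← F.unit_naturality, G.map_comp, ← Category.assoc, Functor.comp_map,
      G.unit_naturality, Category.assoc]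
  map_assoc m n p := by
    simp only [Iso.trans_hom, mapIso]
    rw [D''.tensMap_comp_id _ _ _ _ (by simp), D''.tensMap_id_comp _ _ _ _ (by simp)]
    simp only [Category.assoc]
    rw [← Category.assoc (D''.tensMap (G.map (F.mu m n).hom) _ _),
      G.mu_naturality_left _ _ (by simp),
      ← Category.assoc (D''.tensMap _ (G.map (F.mu n p).hom) _),
      G.mu_naturality_right _ _ (by simp)]
    simp only [Category.assoc]
    rw [← G.map_comp, ← G.map_comp, ← G.map_comp, F.map_assoc, G.map_comp]
    rw [← Category.assoc (G.mu _ _).hom, ← Category.assoc, G.map_assoc]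
    simp only [Category.assoc]
  map_lam m := by
    simp only [Iso.trans_hom, mapIso]
    rw [D''.tensMap_comp_id _ _ _ _ (by simp)]
    simp only [Category.assoc]
    rw [← Category.assoc (D''.tensMap (G.map (F.unit _).hom) _ _),
      G.mu_naturality_left _ _ (by simp)]
    simp only [Category.assoc]
    rw [← G.map_comp, ← G.map_comp, F.map_lam, G.map_lam]
  map_rho m := by
    simp only [Iso.trans_hom, mapIso]
    rw [D''.tensMap_id_comp _ _ _ _ (by simp)]
    simp only [Category.assoc]
    rw [← Category.assoc (D''.tensMap _ (G.map (F.unit _).hom) _),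
      G.mu_naturality_right _ _ (by simp)]
    simp only [Category.assoc]
    rw [← G.map_comp, ← G.map_comp, F.map_rho, G.map_rho]

end DoubleFunctor

/-- A vertical transformation of double functors extending the natural transformation `t`. -/
structure VerticalTrans {C : Type u} [Category.{v} C] {C' : Type u'} [Category.{v'} C']
    {F₀ G₀ : C ⥤ C'} (t : F₀ ⟶ G₀) {D : DoubleCat.{w, z} C} {D' : DoubleCat.{w', z'} C'}
    (F : DoubleFunctor F₀ D D') (G : DoubleFunctor G₀ D D') where
  app {A B : C} (m : D.Pro A B) : ProTotal.of (F.obj m) ⟶ ProTotal.of (G.obj m)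
  sMap_app {A B : C} (m : D.Pro A B) : D'.sMap (app m) = t.app A
  tMap_app {A B : C} (m : D.Pro A B) : D'.tMap (app m) = t.app B
  naturality {A B A' B' : C} {m : D.Pro A B} {n : D.Pro A' B'}
    (α : ProTotal.of m ⟶ ProTotal.of n) : F.map α ≫ app n = app m ≫ G.map α
  app_tens {A B E : C} (m : D.Pro A B) (n : D.Pro B E) :
    D'.tensMap (app m) (app n) ((tMap_app m).trans (sMap_app n).symm) ≫ (G.mu m n).hom =
      (F.mu m n).hom ≫ app (D.tens m n)
  app_y (A : C) : D'.yMap (t.app A) ≫ (G.unit A).hom = (F.unit A).hom ≫ app (D.y A)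

/-- An adjunction between double functors (pseudo functors with vertical transformations as unit
and counit) extending the adjunction `adj` between ordinary functors. -/
structure DoubleAdjunction {C : Type u} [Category.{v} C] {C' : Type u'} [Category.{v'} C']
    {F₀ : C ⥤ C'} {G₀ : C' ⥤ C} (adj : F₀ ⊣ G₀)
    {D : DoubleCat.{w, z} C} {D' : DoubleCat.{w', z'} C'}
    (F : DoubleFunctor F₀ D D') (G : DoubleFunctor G₀ D' D) where
  unit : VerticalTrans adj.unit (DoubleFunctor.id D) (F.comp G)
  counit : VerticalTrans adj.counit (G.comp F) (DoubleFunctor.id D')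
  left_triangle {A B : C} (m : D.Pro A B) :
    F.map (unit.app m) ≫ counit.app (F.obj m) = 𝟙 (ProTotal.of (F.obj m))
  right_triangle {A B : C'} (m : D'.Pro A B) :
    unit.app (G.obj m) ≫ G.map (counit.app m) = 𝟙 (ProTotal.of (G.obj m))

/-- An adjoint equivalence of double categories extending the adjoint equivalence `e` of ordinary
categories: an adjunction of pseudo double functors with invertible unit and counit. -/
structure DoubleAdjointEquivalence {C : Type u} [Category.{v} C] {C' : Type u'} [Category.{v'} C']
    (e : C ≌ C') (D : DoubleCat.{w, z} C) (D' : DoubleCat.{w', z'} C') where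
  functor : DoubleFunctor e.functor D D'
  inverse : DoubleFunctor e.inverse D' D
  adj : DoubleAdjunction e.toAdjunction functor inverse
  isIso_unit {A B : C} (m : D.Pro A B) : IsIso (adj.unit.app m)
  isIso_counit {A B : C'} (m : D'.Pro A B) : IsIso (adj.counit.app m)

/-! ### Cartesian double categories -/

namespace DoubleCat

variable {C : Type u} [Category.{v} C] {C' : Type u'} [Category.{v'} C']

/-- Proarrows of a product of double categories. -/
abbrev ProdPro (D : DoubleCat.{w, z} C) (D' : DoubleCat.{w', z'} C') (X Y : C × C') :
    Type max w w' :=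
  D.Pro X.1 Y.1 × D'.Pro X.2 Y.2

instance prodCat (D : DoubleCat.{w, z} C) (D' : DoubleCat.{w', z'} C') :
    Category.{max z z'} (ProTotal (ProdPro D D')) where
  Hom X Y := (ProTotal.of X.pro.1 ⟶ ProTotal.of Y.pro.1) ×
    (ProTotal.of X.pro.2 ⟶ ProTotal.of Y.pro.2)
  id X := (𝟙 (ProTotal.of X.pro.1), 𝟙 (ProTotal.of X.pro.2))
  comp α β := (α.1 ≫ β.1, α.2 ≫ β.2)
  id_comp α := Prod.ext (Category.id_comp α.1) (Category.id_comp α.2)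
  comp_id α := Prod.ext (Category.comp_id α.1) (Category.comp_id α.2)
  assoc α β γ := Prod.ext (Category.assoc α.1 β.1 γ.1) (Category.assoc α.2 β.2 γ.2)

/-- The product of two double categories. -/
def prod (D : DoubleCat.{w, z} C) (D' : DoubleCat.{w', z'} C') :
    DoubleCat.{max w w', max z z'} (C × C') where
  Pro := ProdPro D D'
  cat := prodCat D D'
  sMap α := (D.sMap α.1, D'.sMap α.2)
  tMap α := (D.tMap α.1, D'.tMap α.2)
  sMap_id m := Prod.ext (D.sMap_id m.1) (D'.sMap_id m.2)
  tMap_id m := Prod.ext (D.tMap_id m.1) (D'.tMap_id m.2)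
  sMap_comp α β := Prod.ext (D.sMap_comp α.1 β.1) (D'.sMap_comp α.2 β.2)
  tMap_comp α β := Prod.ext (D.tMap_comp α.1 β.1) (D'.tMap_comp α.2 β.2)
  y A := (D.y A.1, D'.y A.2)
  yMap f := (D.yMap f.1, D'.yMap f.2)
  sMap_yMap f := Prod.ext (D.sMap_yMap f.1) (D'.sMap_yMap f.2)
  tMap_yMap f := Prod.ext (D.tMap_yMap f.1) (D'.tMap_yMap f.2)
  yMap_id A := Prod.ext (D.yMap_id A.1) (D'.yMap_id A.2)
  yMap_comp f g := Prod.ext (D.yMap_comp f.1 g.1) (D'.yMap_comp f.2 g.2)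
  tens m n := (D.tens m.1 n.1, D'.tens m.2 n.2)
  tensMap α β h := (D.tensMap α.1 β.1 (congrArg Prod.fst h),
    D'.tensMap α.2 β.2 (congrArg Prod.snd h))
  sMap_tensMap α β _ := Prod.ext (D.sMap_tensMap α.1 β.1 _) (D'.sMap_tensMap α.2 β.2 _)
  tMap_tensMap α β _ := Prod.ext (D.tMap_tensMap α.1 β.1 _) (D'.tMap_tensMap α.2 β.2 _)
  tensMap_id m n := Prod.ext (D.tensMap_id m.1 n.1) (D'.tensMap_id m.2 n.2)
  tensMap_comp α β α' β' h h' :=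
    Prod.ext (D.tensMap_comp α.1 β.1 α'.1 β'.1 (congrArg Prod.fst h) (congrArg Prod.fst h'))
      (D'.tensMap_comp α.2 β.2 α'.2 β'.2 (congrArg Prod.snd h) (congrArg Prod.snd h'))
  assoc m n p :=
    { hom := ((D.assoc m.1 n.1 p.1).hom, (D'.assoc m.2 n.2 p.2).hom)
      inv := ((D.assoc m.1 n.1 p.1).inv, (D'.assoc m.2 n.2 p.2).inv)
      hom_inv_id := Prod.ext (D.assoc m.1 n.1 p.1).hom_inv_id (D'.assoc m.2 n.2 p.2).hom_inv_id
      inv_hom_id := Prod.ext (D.assoc m.1 n.1 p.1).inv_hom_id (D'.assoc m.2 n.2 p.2).inv_hom_id }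
  sMap_assoc m n p := Prod.ext (D.sMap_assoc m.1 n.1 p.1) (D'.sMap_assoc m.2 n.2 p.2)
  tMap_assoc m n p := Prod.ext (D.tMap_assoc m.1 n.1 p.1) (D'.tMap_assoc m.2 n.2 p.2)
  assoc_naturality α β γ h h' :=
    Prod.ext (D.assoc_naturality α.1 β.1 γ.1 (congrArg Prod.fst h) (congrArg Prod.fst h'))
      (D'.assoc_naturality α.2 β.2 γ.2 (congrArg Prod.snd h) (congrArg Prod.snd h'))
  lam m :=
    { hom := ((D.lam m.1).hom, (D'.lam m.2).hom)
      inv := ((D.lam m.1).inv, (D'.lam m.2).inv)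
      hom_inv_id := Prod.ext (D.lam m.1).hom_inv_id (D'.lam m.2).hom_inv_id
      inv_hom_id := Prod.ext (D.lam m.1).inv_hom_id (D'.lam m.2).inv_hom_id }
  sMap_lam m := Prod.ext (D.sMap_lam m.1) (D'.sMap_lam m.2)
  tMap_lam m := Prod.ext (D.tMap_lam m.1) (D'.tMap_lam m.2)
  lam_naturality α := Prod.ext (D.lam_naturality α.1) (D'.lam_naturality α.2)
  rho m :=
    { hom := ((D.rho m.1).hom, (D'.rho m.2).hom)
      inv := ((D.rho m.1).inv, (D'.rho m.2).inv)
      hom_inv_id := Prod.ext (D.rho m.1).hom_inv_id (D'.rho m.2).hom_inv_id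
      inv_hom_id := Prod.ext (D.rho m.1).inv_hom_id (D'.rho m.2).inv_hom_id }
  sMap_rho m := Prod.ext (D.sMap_rho m.1) (D'.sMap_rho m.2)
  tMap_rho m := Prod.ext (D.tMap_rho m.1) (D'.tMap_rho m.2)
  rho_naturality α := Prod.ext (D.rho_naturality α.1) (D'.rho_naturality α.2)
  pentagon m n p q := Prod.ext (D.pentagon m.1 n.1 p.1 q.1) (D'.pentagon m.2 n.2 p.2 q.2)
  triangle m n := Prod.ext (D.triangle m.1 n.1) (D'.triangle m.2 n.2)

/-- Proarrows of the terminal double category. -/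
abbrev OnePro (_ _ : Discrete PUnit.{1}) : Type := PUnit

instance oneCat : Category.{0} (ProTotal OnePro) where
  Hom _ _ := PUnit
  id _ := PUnit.unit
  comp _ _ := PUnit.unit

/-- The terminal double category, with one object, arrow, proarrow and cell. -/
def one : DoubleCat.{0, 0} (Discrete PUnit.{1}) where
  Pro := OnePro
  cat := oneCat
  sMap _ := eqToHom (Subsingleton.elim _ _)
  tMap _ := eqToHom (Subsingleton.elim _ _)
  sMap_id _ := Subsingleton.elim _ _
  tMap_id _ := Subsingleton.elim _ _
  sMap_comp _ _ := Subsingleton.elim _ _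
  tMap_comp _ _ := Subsingleton.elim _ _
  y _ := PUnit.unit
  yMap _ := PUnit.unit
  sMap_yMap _ := Subsingleton.elim _ _
  tMap_yMap _ := Subsingleton.elim _ _
  yMap_id _ := rfl
  yMap_comp _ _ := rfl
  tens _ _ := PUnit.unit
  tensMap _ _ _ := PUnit.unit
  sMap_tensMap _ _ _ := Subsingleton.elim _ _
  tMap_tensMap _ _ _ := Subsingleton.elim _ _
  tensMap_id _ _ := rfl
  tensMap_comp _ _ _ _ _ _ := rfl
  assoc _ _ _ := { hom := PUnit.unit, inv := PUnit.unit, hom_inv_id := rfl, inv_hom_id := rfl }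
  sMap_assoc _ _ _ := Subsingleton.elim _ _
  tMap_assoc _ _ _ := Subsingleton.elim _ _
  assoc_naturality _ _ _ _ _ := rfl
  lam _ := { hom := PUnit.unit, inv := PUnit.unit, hom_inv_id := rfl, inv_hom_id := rfl }
  sMap_lam _ := Subsingleton.elim _ _
  tMap_lam _ := Subsingleton.elim _ _
  lam_naturality _ := rfl
  rho _ := { hom := PUnit.unit, inv := PUnit.unit, hom_inv_id := rfl, inv_hom_id := rfl }
  sMap_rho _ := Subsingleton.elim _ _
  tMap_rho _ := Subsingleton.elim _ _
  rho_naturality _ := rfl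
  pentagon _ _ _ _ := rfl
  triangle _ _ := rfl

/-- The diagonal double functor. -/
def diag (D : DoubleCat.{w, z} C) : DoubleFunctor (Functor.diag C) D (D.prod D) where
  obj m := (m, m)
  map α := (α, α)
  sMap_map _ := rfl
  tMap_map _ := rfl
  map_id _ := rfl
  map_comp _ _ := rfl
  mu _ _ := Iso.refl _
  sMap_mu _ _ := (D.prod D).sMap_id _
  tMap_mu _ _ := (D.prod D).tMap_id _
  mu_naturality α β h := (Category.comp_id _).trans (Category.id_comp _).symm
  unit _ := Iso.refl _
  sMap_unit _ := (D.prod D).sMap_id _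
  tMap_unit _ := (D.prod D).tMap_id _
  unit_naturality f := (Category.comp_id _).trans (Category.id_comp _).symm
  map_assoc m n p := by
    simp only [Iso.refl_hom]
    erw [(D.prod D).tensMap_id, (D.prod D).tensMap_id, Category.id_comp, Category.id_comp,
      Category.id_comp, Category.comp_id]
    rfl
  map_lam m := by
    simp only [Iso.refl_hom]
    erw [(D.prod D).tensMap_id, Category.id_comp, Category.id_comp]
    rfl
  map_rho m := by
    simp only [Iso.refl_hom]
    erw [(D.prod D).tensMap_id, Category.id_comp, Category.id_comp]
    rfl

/-- The unique double functor to the terminal double category. -/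
def toOne (D : DoubleCat.{w, z} C) : DoubleFunctor (Functor.star C) D one where
  obj _ := PUnit.unit
  map _ := PUnit.unit
  sMap_map _ := Subsingleton.elim _ _
  tMap_map _ := Subsingleton.elim _ _
  map_id _ := rfl
  map_comp _ _ := rfl
  mu _ _ := Iso.refl _
  sMap_mu _ _ := Subsingleton.elim _ _
  tMap_mu _ _ := Subsingleton.elim _ _
  mu_naturality _ _ _ := rfl
  unit _ := Iso.refl _
  sMap_unit _ := Subsingleton.elim _ _
  tMap_unit _ := Subsingleton.elim _ _
  unit_naturality _ := rfl
  map_assoc _ _ _ := rfl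
  map_lam _ := rfl
  map_rho _ := rfl

/-- `F` has a right adjoint in the 2-category of double categories, pseudo double functors and
vertical transformations. -/
def HasRightAdjoint {F₀ : C ⥤ C'} {D : DoubleCat.{w, z} C} {D' : DoubleCat.{w', z'} C'}
    (F : DoubleFunctor F₀ D D') : Prop :=
  ∃ (G₀ : C' ⥤ C) (adj : F₀ ⊣ G₀) (G : DoubleFunctor G₀ D' D), Nonempty (DoubleAdjunction adj F G)

/-- A cartesian double category. -/
def IsCartesian (D : DoubleCat.{w, z} C) : Prop :=
  HasRightAdjoint D.diag ∧ HasRightAdjoint D.toOne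

/-! ### Equipments -/

/-- A companion of the arrow `f`. -/
structure Companion (D : DoubleCat.{w, z} C) {A B : C} (f : A ⟶ B) where
  pro : D.Pro A B
  eta : ProTotal.of (D.y A) ⟶ ProTotal.of pro
  eps : ProTotal.of pro ⟶ ProTotal.of (D.y B)
  sMap_eta : D.sMap eta = 𝟙 A
  tMap_eta : D.tMap eta = f
  sMap_eps : D.sMap eps = f
  tMap_eps : D.tMap eps = 𝟙 B
  eta_tens_eps : (D.lam pro).inv ≫ D.tensMap eta eps (tMap_eta.trans sMap_eps.symm) ≫
    (D.rho pro).hom = 𝟙 (ProTotal.of pro)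
  eta_eps : eta ≫ eps = D.yMap f

/-- A conjoint of the arrow `f`. -/
structure Conjoint (D : DoubleCat.{w, z} C) {A B : C} (f : A ⟶ B) where
  pro : D.Pro B A
  eta : ProTotal.of (D.y A) ⟶ ProTotal.of pro
  eps : ProTotal.of pro ⟶ ProTotal.of (D.y B)
  sMap_eta : D.sMap eta = f
  tMap_eta : D.tMap eta = 𝟙 A
  sMap_eps : D.sMap eps = 𝟙 B
  tMap_eps : D.tMap eps = f
  eps_tens_eta : (D.rho pro).inv ≫ D.tensMap eps eta (tMap_eps.trans sMap_eta.symm) ≫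
    (D.lam pro).hom = 𝟙 (ProTotal.of pro)
  eta_eps : eta ≫ eps = D.yMap f

/-- An equipment: every arrow has a companion and a conjoint. -/
def IsEquipment (D : DoubleCat.{w, z} C) : Prop :=
  ∀ {A B : C} (f : A ⟶ B), Nonempty (D.Companion f) ∧ Nonempty (D.Conjoint f)

/-- The cell `θ` is cartesian; then it is called the restriction of its codomain along its
vertical boundary. -/
def IsRestriction (D : DoubleCat.{w, z} C) {A B A' B' : C} {m : D.Pro A B} {n : D.Pro A' B'}
    (θ : ProTotal.of m ⟶ ProTotal.of n) : Prop :=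
  ∀ {X Y : C} (p : D.Pro X Y) (δ : ProTotal.of p ⟶ ProTotal.of n) (h : X ⟶ A) (k : Y ⟶ B),
    D.sMap δ = h ≫ D.sMap θ → D.tMap δ = k ≫ D.tMap θ →
      ∃! γ : ProTotal.of p ⟶ ProTotal.of m, D.sMap γ = h ∧ D.tMap γ = k ∧ γ ≫ θ = δ

/-- The cell `θ` is opcartesian; then it is called the extension of its domain along its
vertical boundary. -/
def IsExtension (D : DoubleCat.{w, z} C) {A B A' B' : C} {m : D.Pro A B} {n : D.Pro A' B'}
    (θ : ProTotal.of m ⟶ ProTotal.of n) : Prop :=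
  ∀ {X Y : C} (p : D.Pro X Y) (δ : ProTotal.of m ⟶ ProTotal.of p) (h : A' ⟶ X) (k : B' ⟶ Y),
    D.sMap δ = D.sMap θ ≫ h → D.tMap δ = D.tMap θ ≫ k →
      ∃! γ : ProTotal.of n ⟶ ProTotal.of p, D.sMap γ = h ∧ D.tMap γ = k ∧ θ ≫ γ = δ

/-- `e` is a cover: for the extension `ξ` of the unit along `e` (its cokernel), the canonical
globular cell from the cokernel to the unit proarrow is invertible. -/
def IsCover (D : DoubleCat.{w, z} C) {A E : C} (e : A ⟶ E) : Prop :=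
  ∃ (k : D.Pro E E) (ξ : ProTotal.of (D.y A) ⟶ ProTotal.of k)
    (γ : ProTotal.of k ⟶ ProTotal.of (D.y E)),
    D.IsExtension ξ ∧ D.sMap ξ = e ∧ D.tMap ξ = e ∧
      D.sMap γ = 𝟙 E ∧ D.tMap γ = 𝟙 E ∧ ξ ≫ γ = D.yMap e ∧ IsIso γ

/-- `i` is an inclusion: for the restriction `ρ` of the unit along `i` (its kernel), the canonical
globular cell from the unit proarrow to the kernel is invertible. -/
def IsInclusion (D : DoubleCat.{w, z} C) {E B : C} (i : E ⟶ B) : Prop :=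
  ∃ (k : D.Pro E E) (ρ : ProTotal.of k ⟶ ProTotal.of (D.y B))
    (γ : ProTotal.of (D.y E) ⟶ ProTotal.of k),
    D.IsRestriction ρ ∧ D.sMap ρ = i ∧ D.tMap ρ = i ∧
      D.sMap γ = 𝟙 E ∧ D.tMap γ = 𝟙 E ∧ γ ≫ ρ = D.yMap i ∧ IsIso γ

/-- The class of covers. -/
def covers (D : DoubleCat.{w, z} C) : MorphismProperty C := fun _ _ e => D.IsCover e

/-- The class of inclusions. -/
def inclusions (D : DoubleCat.{w, z} C) : MorphismProperty C := fun _ _ i => D.IsInclusion i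

/-- The span `(l, r)` is a relation: its pairing `⟨l, r⟩ : R ⟶ A × B` is an inclusion. -/
def IsRelation (D : DoubleCat.{w, z} C) {R A B : C} (l : R ⟶ A) (r : R ⟶ B) : Prop :=
  ∃ (c : BinaryFan A B) (hc : IsLimit c), D.IsInclusion (hc.lift (BinaryFan.mk l r))

/-! ### Tabulators -/

/-- Tabulators exist: the external unit functor has a right adjoint. -/
def HasTabulators (D : DoubleCat.{w, z} C) : Prop := D.unitFunctor.IsLeftAdjoint

/-- The object `T` with the cell `τ` is a tabulator of `m`: `τ` is a universal arrow from the
external unit functor to `m`, that is, up to isomorphism the value of its right adjoint at `m`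
with the component of the counit. The legs of the tabulator are `sMap τ` and `tMap τ`. -/
def IsTabulator (D : DoubleCat.{w, z} C) {A B T : C} {m : D.Pro A B}
    (τ : ProTotal.of (D.y T) ⟶ ProTotal.of m) : Prop :=
  ∀ {X : C} (θ : ProTotal.of (D.y X) ⟶ ProTotal.of m), ∃! u : X ⟶ T, D.yMap u ≫ τ = θ

/-- Tabulators are strong: each proarrow is the extension of the unit along the legs of its
tabulator. -/
def TabulatorsStrong (D : DoubleCat.{w, z} C) : Prop :=
  ∀ {A B T : C} {m : D.Pro A B} (τ : ProTotal.of (D.y T) ⟶ ProTotal.of m),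
    D.IsTabulator τ → D.IsExtension τ

/-- Tabulators are discrete: the legs of each tabulator are jointly an inclusion. -/
def TabulatorsDiscrete (D : DoubleCat.{w, z} C) : Prop :=
  ∀ {A B T : C} {m : D.Pro A B} (τ : ProTotal.of (D.y T) ⟶ ProTotal.of m),
    D.IsTabulator τ → D.IsRelation (D.sMap τ) (D.tMap τ)

/-- Tabulators are externally functorial. Let `(I, i₁, i₂)` be the composite of the tabulators of
`p` and `q` as relations: the image (cover `e` followed by a relation) of the span formed on their
pullback `P`. Then the induced morphism `γ` from `I` to the tabulator of `p ⊗ q` is invertible. -/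
def TabulatorsFunctorial (D : DoubleCat.{w, z} C) : Prop :=
  ∀ {A B E T₁ T₂ T : C} (p : D.Pro A B) (q : D.Pro B E)
    (τ₁ : ProTotal.of (D.y T₁) ⟶ ProTotal.of p) (τ₂ : ProTotal.of (D.y T₂) ⟶ ProTotal.of q)
    (τ : ProTotal.of (D.y T) ⟶ ProTotal.of (D.tens p q)),
    D.IsTabulator τ₁ → D.IsTabulator τ₂ → D.IsTabulator τ →
    ∀ {P : C} (a : P ⟶ T₁) (b : P ⟶ T₂) (sq : IsPullback a b (D.tMap τ₁) (D.sMap τ₂))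
      {I : C} (e : P ⟶ I) (i₁ : I ⟶ A) (i₂ : I ⟶ E),
      D.IsCover e → D.IsRelation i₁ i₂ →
      e ≫ i₁ = a ≫ D.sMap τ₁ → e ≫ i₂ = b ≫ D.tMap τ₂ →
      ∀ γ : I ⟶ T, γ ≫ D.sMap τ = i₁ → γ ≫ D.tMap τ = i₂ →
        D.yMap (e ≫ γ) ≫ τ = (D.lam (D.y P)).inv ≫
          D.tensMap (D.yMap a ≫ τ₁) (D.yMap b ≫ τ₂)
            (by rw [D.tMap_comp, D.sMap_comp, D.tMap_yMap, D.sMap_yMap, sq.w]) →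
        IsIso γ

/-- Every relation is a tabulator (of some proarrow). -/
def RelationsAreTabulators (D : DoubleCat.{w, z} C) : Prop :=
  ∀ {R A B : C} (l : R ⟶ A) (r : R ⟶ B), D.IsRelation l r →
    ∃ (m : D.Pro A B) (τ : ProTotal.of (D.y R) ⟶ ProTotal.of m),
      D.IsTabulator τ ∧ D.sMap τ = l ∧ D.tMap τ = r

/-! ### Local products and the Frobenius law -/

/-- Proarrows from `A` to `B`, as objects of the category of globular cells. -/
structure Local (D : DoubleCat.{w, z} C) (A B : C) where
  of ::
  pro : D.Pro A B

instance (D : DoubleCat.{w, z} C) (A B : C) : Category (D.Local A B) where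
  Hom m n := { α : ProTotal.of m.pro ⟶ ProTotal.of n.pro // D.sMap α = 𝟙 A ∧ D.tMap α = 𝟙 B }
  id m := ⟨𝟙 (ProTotal.of m.pro), D.sMap_id _, D.tMap_id _⟩
  comp α β := ⟨α.1 ≫ β.1, by rw [D.sMap_comp, α.2.1, β.2.1, Category.id_comp],
    by rw [D.tMap_comp, α.2.2, β.2.2, Category.id_comp]⟩
  id_comp α := Subtype.ext (Category.id_comp α.1)
  comp_id α := Subtype.ext (Category.comp_id α.1)
  assoc α β γ := Subtype.ext (Category.assoc α.1 β.1 γ.1)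

/-- The Frobenius law `r ∧ (f^* ⊗ q) ≅ f^* ⊗ ((f_! ⊗ r) ∧ q)`, where `∧` is the product in a
category of proarrows with fixed ends and globular cells. -/
def Frobenius (D : DoubleCat.{w, z} C) : Prop :=
  ∀ {A B X : C} (f : A ⟶ B) (fl : D.Companion f) (fu : D.Conjoint f)
    (r : D.Pro B X) (q : D.Pro A X)
    (c : BinaryFan (Local.of r : D.Local B X) (Local.of (D.tens fu.pro q)))
    (d : BinaryFan (Local.of (D.tens fl.pro r) : D.Local A X) (Local.of q)),
    Nonempty (IsLimit c) → Nonempty (IsLimit d) →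
      Nonempty (c.pt ≅ Local.of (D.tens fu.pro d.pt.pro))

end DoubleCat

/-! ### Factorization systems -/

/-- `(E, M)` is an orthogonal factorization system. -/
structure IsOrthogonalFactorizationSystem {C : Type u} [Category.{v} C]
    (E M : MorphismProperty C) : Prop where
  iso_left {X Y : C} (f : X ⟶ Y) [IsIso f] : E f
  iso_right {X Y : C} (f : X ⟶ Y) [IsIso f] : M f
  comp_left {X Y Z : C} (f : X ⟶ Y) (g : Y ⟶ Z) : E f → E g → E (f ≫ g)
  comp_right {X Y Z : C} (f : X ⟶ Y) (g : Y ⟶ Z) : M f → M g → M (f ≫ g)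
  fact {X Y : C} (f : X ⟶ Y) : ∃ (I : C) (e : X ⟶ I) (m : I ⟶ Y), E e ∧ M m ∧ e ≫ m = f
  lift {X Y A B : C} (e : X ⟶ Y) (m : A ⟶ B) (a : X ⟶ A) (b : Y ⟶ B) :
    E e → M m → e ≫ b = a ≫ m → ∃! d : Y ⟶ A, e ≫ d = a ∧ d ≫ m = b

/-- `(E, M)` is a proper and stable orthogonal factorization system. -/
structure IsProperStableFactorizationSystem {C : Type u} [Category.{v} C]
    (E M : MorphismProperty C) : Prop extends IsOrthogonalFactorizationSystem E M where
  epi {X Y : C} (f : X ⟶ Y) : E f → Epi f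
  mono {X Y : C} (f : X ⟶ Y) : M f → Mono f
  stable {P A B X : C} {d : P ⟶ A} {c : P ⟶ B} {h : A ⟶ X} {e : B ⟶ X} :
    IsPullback d c h e → E e → E d

/-! ### The double category of relations -/

section Rel

variable {C : Type u} [Category.{v} C] [HasFiniteLimits C] {E M : MorphismProperty C}

/-- A relation from `A` to `B`: a span whose legs are jointly in `M`. -/
structure RelPro (M : MorphismProperty C) (A B : C) where
  apex : C
  l : apex ⟶ A
  r : apex ⟶ B
  mem : M (prod.lift l r)

/-- A morphism of relations: a commuting morphism of spans. -/
@[ext]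
structure RelCell {A B A' B' : C} (R : RelPro M A B) (S : RelPro M A' B') where
  left : A ⟶ A'
  right : B ⟶ B'
  apex : R.apex ⟶ S.apex
  comm_l : apex ≫ S.l = R.l ≫ left
  comm_r : apex ≫ S.r = R.r ≫ right

/-- The category of relations and morphisms of spans. -/
instance relCat (M : MorphismProperty C) : Category.{v} (ProTotal (RelPro M)) where
  Hom X Y := RelCell X.pro Y.pro
  id X := ⟨𝟙 _, 𝟙 _, 𝟙 _, by simp, by simp⟩
  comp α β := ⟨α.left ≫ β.left, α.right ≫ β.right, α.apex ≫ β.apex,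
    by rw [Category.assoc, β.comm_l, ← Category.assoc, α.comm_l, Category.assoc],
    by rw [Category.assoc, β.comm_r, ← Category.assoc, α.comm_r, Category.assoc]⟩
  id_comp α := RelCell.ext (Category.id_comp _) (Category.id_comp _) (Category.id_comp _)
  comp_id α := RelCell.ext (Category.comp_id _) (Category.comp_id _) (Category.comp_id _)
  assoc α β γ := RelCell.ext (Category.assoc _ _ _) (Category.assoc _ _ _) (Category.assoc _ _ _)

lemma RelCell.comp_left {X Y Z : ProTotal (RelPro M)} (α : X ⟶ Y) (β : Y ⟶ Z) :
    RelCell.left (α ≫ β) = RelCell.left α ≫ RelCell.left β := rfl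

lemma RelCell.comp_right {X Y Z : ProTotal (RelPro M)} (α : X ⟶ Y) (β : Y ⟶ Z) :
    RelCell.right (α ≫ β) = RelCell.right α ≫ RelCell.right β := rfl

lemma RelCell.id_left (X : ProTotal (RelPro M)) : RelCell.left (𝟙 X) = 𝟙 X.src := rfl

lemma RelCell.id_right (X : ProTotal (RelPro M)) : RelCell.right (𝟙 X) = 𝟙 X.tgt := rfl

namespace IsProperStableFactorizationSystem

lemma relCell_ext (F : IsProperStableFactorizationSystem E M) {A B A' B' : C}
    {R : RelPro M A B} {S : RelPro M A' B'}
    (α β : RelCell R S) (hl : α.left = β.left) (hr : α.right = β.right) : α = β := by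
  have := F.mono _ S.mem
  refine RelCell.ext hl hr ?_
  rw [← cancel_mono (prod.lift S.l S.r)]
  ext
  · simp only [Category.assoc, prod.lift_fst, α.comm_l, β.comm_l, hl]
  · simp only [Category.assoc, prod.lift_snd, α.comm_r, β.comm_r, hr]

lemma exists_image (F : IsProperStableFactorizationSystem E M) {A B P : C} (a : P ⟶ A)
    (b : P ⟶ B) :
    ∃ (R : RelPro M A B) (e : P ⟶ R.apex), E e ∧ e ≫ R.l = a ∧ e ≫ R.r = b := by
  obtain ⟨I, e, m, he, hm, h⟩ := F.fact (prod.lift a b)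
  have hm' : prod.lift (m ≫ prod.fst) (m ≫ prod.snd) = m := by
    ext
    · rw [prod.lift_fst]
    · rw [prod.lift_snd]
  refine ⟨⟨I, m ≫ prod.fst, m ≫ prod.snd, by rw [hm']; exact hm⟩, e, he, ?_, ?_⟩
  · rw [← Category.assoc, h, prod.lift_fst]
  · rw [← Category.assoc, h, prod.lift_snd]

lemma exists_descend (F : IsProperStableFactorizationSystem E M) {A B P I : C} (S : RelPro M A B)
    {e : P ⟶ I} (he : E e) (a : P ⟶ S.apex) (f : I ⟶ A) (g : I ⟶ B)
    (hf : e ≫ f = a ≫ S.l) (hg : e ≫ g = a ≫ S.r) :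
    ∃ d : I ⟶ S.apex, e ≫ d = a ∧ d ≫ S.l = f ∧ d ≫ S.r = g := by
  obtain ⟨d, ⟨h₁, h₂⟩, -⟩ := F.lift e (prod.lift S.l S.r) a (prod.lift f g) he S.mem
    (by
      ext
      · simp only [Category.assoc, prod.lift_fst, hf]
      · simp only [Category.assoc, prod.lift_snd, hg])
  refine ⟨d, h₁, ?_, ?_⟩
  · simpa only [Category.assoc, prod.lift_fst] using congrArg (· ≫ prod.fst) h₂
  · simpa only [Category.assoc, prod.lift_snd] using congrArg (· ≫ prod.snd) h₂

lemma diag_mem (F : IsProperStableFactorizationSystem E M) (A : C) :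
    M (prod.lift (𝟙 A) (𝟙 A)) := by
  obtain ⟨I, e, m, he, hm, h⟩ := F.fact (prod.lift (𝟙 A) (𝟙 A))
  have := F.epi e he
  have h1 : e ≫ (m ≫ prod.fst) = 𝟙 A := by rw [← Category.assoc, h, prod.lift_fst]
  have : IsIso e := ⟨m ≫ prod.fst, h1, by
    rw [← cancel_epi e, ← Category.assoc, h1, Category.id_comp, Category.comp_id]⟩
  rw [← h]
  exact F.comp_right _ _ (F.iso_right e) hm

/-- The identity relation: the diagonal. -/
abbrev relUnit (F : IsProperStableFactorizationSystem E M) (A : C) : RelPro M A A :=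
  ⟨A, 𝟙 A, 𝟙 A, F.diag_mem A⟩

/-- The composite relation: the image of the span on the pullback. -/
noncomputable def relComp (F : IsProperStableFactorizationSystem E M) {A B G : C}
    (R : RelPro M A B) (S : RelPro M B G) : RelPro M A G :=
  (F.exists_image (pullback.fst R.r S.l ≫ R.l) (pullback.snd R.r S.l ≫ S.r)).choose

/-- The `E`-part of the image defining the composite relation. -/
noncomputable def relCompE (F : IsProperStableFactorizationSystem E M) {A B G : C}
    (R : RelPro M A B) (S : RelPro M B G) : pullback R.r S.l ⟶ (F.relComp R S).apex :=
  (F.exists_image (pullback.fst R.r S.l ≫ R.l) (pullback.snd R.r S.l ≫ S.r)).choose_spec.choose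

lemma relCompE_mem (F : IsProperStableFactorizationSystem E M) {A B G : C}
    (R : RelPro M A B) (S : RelPro M B G) : E (F.relCompE R S) :=
  (F.exists_image (pullback.fst R.r S.l ≫ R.l)
    (pullback.snd R.r S.l ≫ S.r)).choose_spec.choose_spec.1

lemma relCompE_l (F : IsProperStableFactorizationSystem E M) {A B G : C}
    (R : RelPro M A B) (S : RelPro M B G) :
    F.relCompE R S ≫ (F.relComp R S).l = pullback.fst R.r S.l ≫ R.l :=
  (F.exists_image (pullback.fst R.r S.l ≫ R.l)
    (pullback.snd R.r S.l ≫ S.r)).choose_spec.choose_spec.2.1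

lemma relCompE_r (F : IsProperStableFactorizationSystem E M) {A B G : C}
    (R : RelPro M A B) (S : RelPro M B G) :
    F.relCompE R S ≫ (F.relComp R S).r = pullback.snd R.r S.l ≫ S.r :=
  (F.exists_image (pullback.fst R.r S.l ≫ R.l)
    (pullback.snd R.r S.l ≫ S.r)).choose_spec.choose_spec.2.2

lemma exists_relComp_hom (F : IsProperStableFactorizationSystem E M) {A B G A' B' G' : C}
    {R : RelPro M A B} {S : RelPro M B G} {R' : RelPro M A' B'} {S' : RelPro M B' G'}
    (α : RelCell R R') (β : RelCell S S') (h : α.right = β.left) :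
    ∃ γ : RelCell (F.relComp R S) (F.relComp R' S'), γ.left = α.left ∧ γ.right = β.right := by
  obtain ⟨d, -, hl, hr⟩ := F.exists_descend (F.relComp R' S') (F.relCompE_mem R S)
    (pullback.map R.r S.l R'.r S'.l α.apex β.apex α.right α.comm_r.symm
      (by rw [h]; exact β.comm_l.symm) ≫ F.relCompE R' S')
    ((F.relComp R S).l ≫ α.left) ((F.relComp R S).r ≫ β.right)
    (by rw [← Category.assoc, relCompE_l, Category.assoc, Category.assoc, relCompE_l,
          ← α.comm_l, pullback.lift_fst_assoc, Category.assoc])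
    (by rw [← Category.assoc, relCompE_r, Category.assoc, Category.assoc, relCompE_r,
          ← β.comm_r, pullback.lift_snd_assoc, Category.assoc])
  exact ⟨⟨_, _, d, hl, hr⟩, rfl, rfl⟩

lemma exists_relAssoc_hom (F : IsProperStableFactorizationSystem E M) {A B G H : C}
    (R : RelPro M A B) (S : RelPro M B G) (T : RelPro M G H) :
    ∃ γ : RelCell (F.relComp (F.relComp R S) T) (F.relComp R (F.relComp S T)),
      γ.left = 𝟙 A ∧ γ.right = 𝟙 H := by
  let e := F.relCompE R S
  let p := pullback.fst (F.relComp R S).r T.l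
  let a := pullback.snd p e
  let b := pullback.fst p e ≫ pullback.snd (F.relComp R S).r T.l
  have hE : E (pullback.fst p e ≫ F.relCompE (F.relComp R S) T) :=
    F.comp_left _ _ (F.stable (IsPullback.of_hasPullback p e) (F.relCompE_mem R S))
      (F.relCompE_mem _ _)
  have hpe : pullback.fst p e ≫ p = a ≫ e := pullback.condition
  have h1 : (a ≫ pullback.snd R.r S.l) ≫ S.r = b ≫ T.l := by
    have : (a ≫ e) ≫ (F.relComp R S).r = b ≫ T.l := by
      rw [← hpe, Category.assoc, pullback.condition, ← Category.assoc]
    rw [← this, Category.assoc, Category.assoc, F.relCompE_r]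
  let c : pullback p e ⟶ (F.relComp S T).apex := pullback.lift _ _ h1 ≫ F.relCompE S T
  have h2 : (a ≫ pullback.fst R.r S.l) ≫ R.r = c ≫ (F.relComp S T).l := by
    change _ = (pullback.lift _ _ h1 ≫ F.relCompE S T) ≫ _
    rw [Category.assoc (pullback.lift _ _ h1), F.relCompE_l, pullback.lift_fst_assoc, Category.assoc, Category.assoc,
      pullback.condition]
  obtain ⟨d, -, hl, hr⟩ := F.exists_descend (F.relComp R (F.relComp S T)) hE
    (pullback.lift _ _ h2 ≫ F.relCompE R (F.relComp S T))
    (F.relComp (F.relComp R S) T).l (F.relComp (F.relComp R S) T).r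
    (by
      rw [Category.assoc, Category.assoc, F.relCompE_l, F.relCompE_l, pullback.lift_fst_assoc,
        ← Category.assoc, hpe, Category.assoc, Category.assoc, F.relCompE_l])
    (by
      rw [Category.assoc, Category.assoc, F.relCompE_r, F.relCompE_r, pullback.lift_snd_assoc,
        Category.assoc, F.relCompE_r, pullback.lift_snd_assoc, Category.assoc])
  exact ⟨⟨_, _, d, by simpa using hl, by simpa using hr⟩, rfl, rfl⟩

lemma exists_relAssoc_inv (F : IsProperStableFactorizationSystem E M) {A B G H : C}
    (R : RelPro M A B) (S : RelPro M B G) (T : RelPro M G H) :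
    ∃ γ : RelCell (F.relComp R (F.relComp S T)) (F.relComp (F.relComp R S) T),
      γ.left = 𝟙 A ∧ γ.right = 𝟙 H := by
  let e := F.relCompE S T
  let p := pullback.snd R.r (F.relComp S T).l
  let a := pullback.snd p e
  let b := pullback.fst p e ≫ pullback.fst R.r (F.relComp S T).l
  have hE : E (pullback.fst p e ≫ F.relCompE R (F.relComp S T)) :=
    F.comp_left _ _ (F.stable (IsPullback.of_hasPullback p e) (F.relCompE_mem S T))
      (F.relCompE_mem _ _)
  have hpe : pullback.fst p e ≫ p = a ≫ e := pullback.condition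
  have h1 : b ≫ R.r = (a ≫ pullback.fst S.r T.l) ≫ S.l := by
    have : (a ≫ e) ≫ (F.relComp S T).l = b ≫ R.r := by
      rw [← hpe, Category.assoc, ← pullback.condition, ← Category.assoc]
    rw [← this, Category.assoc, Category.assoc, F.relCompE_l]
  let c : pullback p e ⟶ (F.relComp R S).apex := pullback.lift _ _ h1 ≫ F.relCompE R S
  have h2 : c ≫ (F.relComp R S).r = (a ≫ pullback.snd S.r T.l) ≫ T.l := by
    change (pullback.lift _ _ h1 ≫ F.relCompE R S) ≫ _ = _
    rw [Category.assoc, F.relCompE_r, pullback.lift_snd_assoc, Category.assoc, Category.assoc,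
      pullback.condition]
  obtain ⟨d, -, hl, hr⟩ := F.exists_descend (F.relComp (F.relComp R S) T) hE
    (pullback.lift _ _ h2 ≫ F.relCompE (F.relComp R S) T)
    (F.relComp R (F.relComp S T)).l (F.relComp R (F.relComp S T)).r
    (by
      rw [Category.assoc, Category.assoc, F.relCompE_l, F.relCompE_l, pullback.lift_fst_assoc,
        Category.assoc, F.relCompE_l, pullback.lift_fst_assoc, Category.assoc])
    (by
      rw [Category.assoc, Category.assoc, F.relCompE_r, F.relCompE_r, pullback.lift_snd_assoc,
        ← Category.assoc, hpe, Category.assoc, Category.assoc, F.relCompE_r])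
  exact ⟨⟨_, _, d, by simpa using hl, by simpa using hr⟩, rfl, rfl⟩

lemma exists_relLam_hom (F : IsProperStableFactorizationSystem E M) {A B : C}
    (R : RelPro M A B) :
    ∃ γ : RelCell (F.relComp (F.relUnit A) R) R, γ.left = 𝟙 A ∧ γ.right = 𝟙 B := by
  obtain ⟨d, -, hl, hr⟩ := F.exists_descend R (F.relCompE_mem (F.relUnit A) R)
    (pullback.snd (F.relUnit A).r R.l) (F.relComp (F.relUnit A) R).l
    (F.relComp (F.relUnit A) R).r
    (by rw [F.relCompE_l, ← pullback.condition]) (F.relCompE_r _ _)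
  exact ⟨⟨_, _, d, by simpa using hl, by simpa using hr⟩, rfl, rfl⟩

lemma exists_relLam_inv (F : IsProperStableFactorizationSystem E M) {A B : C}
    (R : RelPro M A B) :
    ∃ γ : RelCell R (F.relComp (F.relUnit A) R), γ.left = 𝟙 A ∧ γ.right = 𝟙 B := by
  have h : R.l ≫ (F.relUnit A).r = 𝟙 R.apex ≫ R.l :=
    (Category.comp_id _).trans (Category.id_comp _).symm
  refine ⟨⟨_, _, pullback.lift _ _ h ≫ F.relCompE _ _, ?_, ?_⟩, rfl, rfl⟩
  · rw [Category.assoc, F.relCompE_l, pullback.lift_fst_assoc]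
  · rw [Category.assoc, F.relCompE_r, pullback.lift_snd_assoc, Category.id_comp, Category.comp_id]

lemma exists_relRho_hom (F : IsProperStableFactorizationSystem E M) {A B : C}
    (R : RelPro M A B) :
    ∃ γ : RelCell (F.relComp R (F.relUnit B)) R, γ.left = 𝟙 A ∧ γ.right = 𝟙 B := by
  obtain ⟨d, -, hl, hr⟩ := F.exists_descend R (F.relCompE_mem R (F.relUnit B))
    (pullback.fst R.r (F.relUnit B).l) (F.relComp R (F.relUnit B)).l
    (F.relComp R (F.relUnit B)).r
    (F.relCompE_l _ _) (by rw [F.relCompE_r, pullback.condition])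
  exact ⟨⟨_, _, d, by simpa using hl, by simpa using hr⟩, rfl, rfl⟩

lemma exists_relRho_inv (F : IsProperStableFactorizationSystem E M) {A B : C}
    (R : RelPro M A B) :
    ∃ γ : RelCell R (F.relComp R (F.relUnit B)), γ.left = 𝟙 A ∧ γ.right = 𝟙 B := by
  have h : 𝟙 R.apex ≫ R.r = R.r ≫ (F.relUnit B).l :=
    (Category.id_comp _).trans (Category.comp_id _).symm
  refine ⟨⟨_, _, pullback.lift _ _ h ≫ F.relCompE _ _, ?_, ?_⟩, rfl, rfl⟩
  · rw [Category.assoc, F.relCompE_l, pullback.lift_fst_assoc, Category.id_comp, Category.comp_id]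
  · rw [Category.assoc, F.relCompE_r, pullback.lift_snd_assoc]

/-- Two opposite globular cells between relations are inverse to each other, since cells between
relations are determined by their vertical boundary. -/
noncomputable def relIso (F : IsProperStableFactorizationSystem E M) {A B : C}
    {R S : RelPro M A B}
    (h : ∃ γ : RelCell R S, γ.left = 𝟙 A ∧ γ.right = 𝟙 B)
    (h' : ∃ γ : RelCell S R, γ.left = 𝟙 A ∧ γ.right = 𝟙 B) :
    (ProTotal.of R : ProTotal (RelPro M)) ≅ ProTotal.of S where
  hom := h.choose
  inv := h'.choose
  hom_inv_id := F.relCell_ext _ _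
    (show h.choose.left ≫ h'.choose.left = 𝟙 A by
      rw [h.choose_spec.1, h'.choose_spec.1, Category.comp_id])
    (show h.choose.right ≫ h'.choose.right = 𝟙 B by
      rw [h.choose_spec.2, h'.choose_spec.2, Category.comp_id])
  inv_hom_id := F.relCell_ext _ _
    (show h'.choose.left ≫ h.choose.left = 𝟙 A by
      rw [h.choose_spec.1, h'.choose_spec.1, Category.comp_id])
    (show h'.choose.right ≫ h.choose.right = 𝟙 B by
      rw [h.choose_spec.2, h'.choose_spec.2, Category.comp_id])

/-- External composition of cells between relations. -/
noncomputable def relCompMap (F : IsProperStableFactorizationSystem E M) {A B G A' B' G' : C}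
    {R : RelPro M A B} {S : RelPro M B G} {R' : RelPro M A' B'} {S' : RelPro M B' G'}
    (α : RelCell R R') (β : RelCell S S') (h : α.right = β.left) :
    RelCell (F.relComp R S) (F.relComp R' S') :=
  (F.exists_relComp_hom α β h).choose

lemma relCompMap_left (F : IsProperStableFactorizationSystem E M) {A B G A' B' G' : C}
    {R : RelPro M A B} {S : RelPro M B G} {R' : RelPro M A' B'} {S' : RelPro M B' G'}
    (α : RelCell R R') (β : RelCell S S') (h : α.right = β.left) :
    (F.relCompMap α β h).left = α.left :=
  (F.exists_relComp_hom α β h).choose_spec.1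

lemma relCompMap_right (F : IsProperStableFactorizationSystem E M) {A B G A' B' G' : C}
    {R : RelPro M A B} {S : RelPro M B G} {R' : RelPro M A' B'} {S' : RelPro M B' G'}
    (α : RelCell R R') (β : RelCell S S') (h : α.right = β.left) :
    (F.relCompMap α β h).right = β.right :=
  (F.exists_relComp_hom α β h).choose_spec.2

lemma relIso_left (F : IsProperStableFactorizationSystem E M) {A B : C} {R S : RelPro M A B}
    (h : ∃ γ : RelCell R S, γ.left = 𝟙 A ∧ γ.right = 𝟙 B)
    (h' : ∃ γ : RelCell S R, γ.left = 𝟙 A ∧ γ.right = 𝟙 B) :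
    RelCell.left (F.relIso h h').hom = 𝟙 A :=
  h.choose_spec.1

lemma relIso_right (F : IsProperStableFactorizationSystem E M) {A B : C} {R S : RelPro M A B}
    (h : ∃ γ : RelCell R S, γ.left = 𝟙 A ∧ γ.right = 𝟙 B)
    (h' : ∃ γ : RelCell S R, γ.left = 𝟙 A ∧ γ.right = 𝟙 B) :
    RelCell.right (F.relIso h h').hom = 𝟙 B :=
  h.choose_spec.2

end IsProperStableFactorizationSystem

open IsProperStableFactorizationSystem in
/-- The double category of relations in `C` relative to the proper and stable factorization
system `(E, M)`. -/
noncomputable def RelDouble (F : IsProperStableFactorizationSystem E M) :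
    DoubleCat.{max u v, v} C where
  Pro := RelPro M
  cat := relCat M
  sMap α := RelCell.left α
  tMap α := RelCell.right α
  sMap_id _ := rfl
  tMap_id _ := rfl
  sMap_comp _ _ := rfl
  tMap_comp _ _ := rfl
  y A := F.relUnit A
  yMap f := ⟨f, f, f, (Category.comp_id f).trans (Category.id_comp f).symm,
    (Category.comp_id f).trans (Category.id_comp f).symm⟩
  sMap_yMap _ := rfl
  tMap_yMap _ := rfl
  yMap_id _ := rfl
  yMap_comp _ _ := rfl
  tens R S := F.relComp R S
  tensMap α β h := F.relCompMap α β h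
  sMap_tensMap α β h := F.relCompMap_left α β h
  tMap_tensMap α β h := F.relCompMap_right α β h
  tensMap_id R S := F.relCell_ext _ _ (F.relCompMap_left _ _ rfl) (F.relCompMap_right _ _ rfl)
  tensMap_comp α β α' β' h h' := F.relCell_ext _ _
    (by simp only [RelCell.comp_left, relCompMap_left])
    (by simp only [RelCell.comp_right, relCompMap_right])
  assoc R S T := F.relIso (F.exists_relAssoc_hom R S T) (F.exists_relAssoc_inv R S T)
  sMap_assoc R S T := F.relIso_left _ _
  tMap_assoc R S T := F.relIso_right _ _
  assoc_naturality α β γ h h' := F.relCell_ext _ _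
    (by
      simp only [RelCell.comp_left, relCompMap_left, relIso_left]
      exact (Category.comp_id _).trans (Category.id_comp _).symm)
    (by
      simp only [RelCell.comp_right, relCompMap_right, relIso_right]
      exact (Category.comp_id _).trans (Category.id_comp _).symm)
  lam R := F.relIso (F.exists_relLam_hom R) (F.exists_relLam_inv R)
  sMap_lam R := F.relIso_left _ _
  tMap_lam R := F.relIso_right _ _
  lam_naturality α := F.relCell_ext _ _
    (by
      simp only [RelCell.comp_left, relCompMap_left, relIso_left]
      exact (Category.comp_id _).trans (Category.id_comp _).symm)
    (by
      simp only [RelCell.comp_right, relCompMap_right, relIso_right]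
      exact (Category.comp_id _).trans (Category.id_comp _).symm)
  rho R := F.relIso (F.exists_relRho_hom R) (F.exists_relRho_inv R)
  sMap_rho R := F.relIso_left _ _
  tMap_rho R := F.relIso_right _ _
  rho_naturality α := F.relCell_ext _ _
    (by
      simp only [RelCell.comp_left, relCompMap_left, relIso_left]
      exact (Category.comp_id _).trans (Category.id_comp _).symm)
    (by
      simp only [RelCell.comp_right, relCompMap_right, relIso_right]
      exact (Category.comp_id _).trans (Category.id_comp _).symm)
  pentagon R S T U := F.relCell_ext _ _
    (by
      simp only [RelCell.comp_left, relCompMap_left, relIso_left, RelCell.id_left]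
      exact Category.id_comp _)
    (by
      simp only [RelCell.comp_right, relCompMap_right, relIso_right, RelCell.id_right]
      exact Category.id_comp _)
  triangle R S := F.relCell_ext _ _
    (by
      simp only [RelCell.comp_left, relCompMap_left, relIso_left, RelCell.id_left]
      exact Category.id_comp _)
    (by
      simp only [RelCell.comp_right, relCompMap_right, relIso_right, RelCell.id_right]
      exact Category.id_comp _)

end Rel

/-! The double category is flat: a cell is determined by its vertical boundary. Inclusions are monic
by unit-purity, so discreteness makes the legs of a tabulator jointly monic. Two cells `m ⇒ n` with
equal boundary therefore restrict to the same map from the tabulator of `m` to that of `n`. Since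
the tabulator cell of `m` is an extension, the two cells agree (`cell_ext`). The same argument shows
that cells `m ⇒ n` over `(f, g)` amount to morphisms of spans between tabulators over `(f, g)`. All
coherence equations become automatic and every question reduces to the existence of a cell,
expressed by `HasCell`.

Limits and factorizations come from tabulating suitable proarrows. A map from `Z` to the tabulator
of the kernel `f_! ⊗ g^*` is a commutative square over the cospan `(f, g)`, so this tabulator is a
pullback. With `t` the map from `X` to the terminal object `1`, the tabulator of the collage `f^* ⊗
t_!` is the image of `f`, the least subobject of the codomain through which `f` factors. Inclusions
are exactly the monomorphisms. A monomorphism `E → B` is moreover the left leg of a tabulator of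
some `B ⇸ 1`, because relations are tabulators. Factoring through a subobject thus becomes the
existence of a cell out of a unit, and such cells descend along covers, which yields orthogonality.

For stability, let `e` be a cover. Then the unit maps to `e^* ⊗ e_!`, so `h_!` maps to `(h_! ⊗ e^*)
⊗ e_!`. Since `h_! ⊗ e^*` is the extension of the unit along the pullback of `(h, e)`, any subobject
through which the pulled-back map factors is everything (`isCover_of_isPullback`).

Finally, passing from a proarrow to its tabulator and from a relation to the proarrow it tabulates
are mutually inverse up to globular cells. Functoriality of tabulators identifies composites of
relations with tabulators of external composites (`exists_relComp_iso`). -/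

namespace DoubleCat

variable {C : Type u} [Category.{v} C]

/-! ### Existence of cells with a given boundary -/

/-- There is a cell from `m` to `n` with vertical boundary `(f, g)`. -/
def HasCell (D : DoubleCat.{w, z} C) {A B A' B' : C} (m : D.Pro A B) (n : D.Pro A' B')
    (f : A ⟶ A') (g : B ⟶ B') : Prop :=
  ∃ α : ProTotal.of m ⟶ ProTotal.of n, D.sMap α = f ∧ D.tMap α = g

lemma HasCell.comp {D : DoubleCat.{w, z} C} {A B A' B' A'' B'' : C} {m : D.Pro A B}
    {n : D.Pro A' B'} {p : D.Pro A'' B''} {f : A ⟶ A'} {g : B ⟶ B'} {f' : A' ⟶ A''}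
    {g' : B' ⟶ B''} (h : D.HasCell m n f g) (h' : D.HasCell n p f' g') :
    D.HasCell m p (f ≫ f') (g ≫ g') := by
  obtain ⟨α, rfl, rfl⟩ := h
  obtain ⟨β, rfl, rfl⟩ := h'
  exact ⟨α ≫ β, by simp, by simp⟩

lemma HasCell.tens {D : DoubleCat.{w, z} C} {A B E A' B' E' : C} {m : D.Pro A B}
    {n : D.Pro B E} {m' : D.Pro A' B'} {n' : D.Pro B' E'} {f : A ⟶ A'} {g : B ⟶ B'}
    {k : E ⟶ E'} (h : D.HasCell m m' f g) (h' : D.HasCell n n' g k) :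
    D.HasCell (D.tens m n) (D.tens m' n') f k := by
  obtain ⟨α, rfl, hα⟩ := h
  obtain ⟨β, hβ, rfl⟩ := h'
  exact ⟨D.tensMap α β (hα.trans hβ.symm), by simp, by simp⟩

lemma hasCell_refl (D : DoubleCat.{w, z} C) {A B : C} (m : D.Pro A B) :
    D.HasCell m m (𝟙 A) (𝟙 B) :=
  ⟨𝟙 _, by simp, by simp⟩

lemma hasCell_yMap (D : DoubleCat.{w, z} C) {A B : C} (f : A ⟶ B) :
    D.HasCell (D.y A) (D.y B) f f :=
  ⟨D.yMap f, by simp, by simp⟩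

lemma sMap_iso_inv (D : DoubleCat.{w, z} C) {A B : C} {m n : D.Pro A B}
    (i : ProTotal.of m ≅ ProTotal.of n) (hs : D.sMap i.hom = 𝟙 A) : D.sMap i.inv = 𝟙 A := by
  have := congrArg D.sMap i.hom_inv_id
  rwa [D.sMap_comp, D.sMap_id, hs, Category.id_comp] at this

lemma tMap_iso_inv (D : DoubleCat.{w, z} C) {A B : C} {m n : D.Pro A B}
    (i : ProTotal.of m ≅ ProTotal.of n) (ht : D.tMap i.hom = 𝟙 B) : D.tMap i.inv = 𝟙 B := by
  have := congrArg D.tMap i.hom_inv_id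
  rwa [D.tMap_comp, D.tMap_id, ht, Category.id_comp] at this

lemma hasCell_inv (D : DoubleCat.{w, z} C) {A B : C} {m n : D.Pro A B}
    (i : ProTotal.of m ≅ ProTotal.of n) (hs : D.sMap i.hom = 𝟙 A) (ht : D.tMap i.hom = 𝟙 B) :
    D.HasCell n m (𝟙 A) (𝟙 B) :=
  ⟨i.inv, D.sMap_iso_inv i hs, D.tMap_iso_inv i ht⟩

lemma hasCell_lam (D : DoubleCat.{w, z} C) {A B : C} (m : D.Pro A B) :
    D.HasCell (D.tens (D.y A) m) m (𝟙 A) (𝟙 B) :=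
  ⟨(D.lam m).hom, by simp, by simp⟩

lemma hasCell_lam_inv (D : DoubleCat.{w, z} C) {A B : C} (m : D.Pro A B) :
    D.HasCell m (D.tens (D.y A) m) (𝟙 A) (𝟙 B) :=
  D.hasCell_inv (D.lam m) (by simp) (by simp)

lemma hasCell_rho (D : DoubleCat.{w, z} C) {A B : C} (m : D.Pro A B) :
    D.HasCell (D.tens m (D.y B)) m (𝟙 A) (𝟙 B) :=
  ⟨(D.rho m).hom, by simp, by simp⟩

lemma hasCell_rho_inv (D : DoubleCat.{w, z} C) {A B : C} (m : D.Pro A B) :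
    D.HasCell m (D.tens m (D.y B)) (𝟙 A) (𝟙 B) :=
  D.hasCell_inv (D.rho m) (by simp) (by simp)

lemma hasCell_assoc_inv (D : DoubleCat.{w, z} C) {A B E G : C} (m : D.Pro A B) (n : D.Pro B E)
    (p : D.Pro E G) :
    D.HasCell (D.tens m (D.tens n p)) (D.tens (D.tens m n) p) (𝟙 A) (𝟙 G) :=
  D.hasCell_inv (D.assoc m n p) (by simp) (by simp)

/-- A pair of cells out of units that agree in the middle yields a cell into the composite. -/
lemma HasCell.unitTens {D : DoubleCat.{w, z} C} {P A B E : C} {m : D.Pro A B} {n : D.Pro B E}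
    {f : P ⟶ A} {g : P ⟶ B} {k : P ⟶ E} (h : D.HasCell (D.y P) m f g)
    (h' : D.HasCell (D.y P) n g k) : D.HasCell (D.y P) (D.tens m n) f k := by
  simpa using (D.hasCell_lam_inv (D.y P)).comp (h.tens h')

/-! ### Unit-pure double categories, covers and inclusions -/

/-- Fullness of the unit functor makes every cell between units of the form `yMap f`, whose two
boundary arrows are both `f`. Equalities of arrows are later obtained by producing such a cell. -/
lemma IsUnitPure.sMap_eq_tMap {D : DoubleCat.{w, z} C} (hD : D.IsUnitPure) {A B : C}
    (α : ProTotal.of (D.y A) ⟶ ProTotal.of (D.y B)) : D.sMap α = D.tMap α := by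
  have : D.unitFunctor.Full := hD
  obtain ⟨f, rfl⟩ := D.unitFunctor.map_surjective (X := A) (Y := B) α
  exact (D.sMap_yMap f).trans (D.tMap_yMap f).symm

lemma IsUnitPure.eq_of_hasCell {D : DoubleCat.{w, z} C} (hD : D.IsUnitPure) {A B : C}
    {f g : A ⟶ B} (h : D.HasCell (D.y A) (D.y B) f g) : f = g := by
  obtain ⟨α, rfl, rfl⟩ := h
  exact hD.sMap_eq_tMap α

lemma IsExtension.hasCell {D : DoubleCat.{w, z} C} {A B A' B' X Y : C} {m : D.Pro A B}
    {n : D.Pro A' B'} {θ : ProTotal.of m ⟶ ProTotal.of n} (hθ : D.IsExtension θ)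
    {p : D.Pro X Y} {h : A' ⟶ X} {k : B' ⟶ Y}
    (hc : D.HasCell m p (D.sMap θ ≫ h) (D.tMap θ ≫ k)) : D.HasCell n p h k := by
  obtain ⟨δ, hs, ht⟩ := hc
  obtain ⟨γ, ⟨h₁, h₂, -⟩, -⟩ := hθ p δ h k hs ht
  exact ⟨γ, h₁, h₂⟩

/-- Boundaries of cells out of units descend along covers. -/
lemma IsCover.hasCell {D : DoubleCat.{w, z} C} {A E X Y : C} {e : A ⟶ E} (he : D.IsCover e)
    {p : D.Pro X Y} {h : E ⟶ X} {k : E ⟶ Y} (hc : D.HasCell (D.y A) p (e ≫ h) (e ≫ k)) :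
    D.HasCell (D.y E) p h k := by
  obtain ⟨m, ξ, γ, hξ, hs, ht, hγs, hγt, -, _⟩ := he
  -- The cell descends to the cokernel `m` by opcartesianness; the inverse of the comparison `γ`
  -- then carries it to the unit on `E`.
  have h₁ : D.HasCell m p h k := hξ.hasCell (by rwa [hs, ht])
  simpa using (D.hasCell_inv (asIso γ) hγs hγt).comp h₁

/-- If `f ≫ i = g ≫ i`, the unit cell of this arrow lifts to the kernel of `i` with boundary `(f,
g)`. The kernel is the unit on `E`, so unit-purity forces `f = g`. -/
lemma IsUnitPure.mono_of_isInclusion {D : DoubleCat.{w, z} C} (hD : D.IsUnitPure) {E B : C}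
    {i : E ⟶ B} (hi : D.IsInclusion i) : Mono i := by
  obtain ⟨m, ρ, γ, hρ, hs, ht, hγs, hγt, -, _⟩ := hi
  refine ⟨fun {Z} f g hfg => hD.eq_of_hasCell ?_⟩
  obtain ⟨α, ⟨h₁, h₂, -⟩, -⟩ := hρ (D.y Z) (D.yMap (f ≫ i)) f g (by simp [hs])
    (by simp [ht, hfg])
  have := HasCell.comp ⟨α, h₁, h₂⟩ (D.hasCell_inv (asIso γ) hγs hγt)
  simpa using this

/-- If `e ≫ f = e ≫ g`, the unit cell of this arrow descends along `e` to a cell between units with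
boundary `(f, g)`. -/
lemma IsUnitPure.epi_of_isCover {D : DoubleCat.{w, z} C} (hD : D.IsUnitPure) {A E : C}
    {e : A ⟶ E} (he : D.IsCover e) : Epi e := by
  refine ⟨fun f g hfg => hD.eq_of_hasCell (he.hasCell ?_)⟩
  rw [← hfg]
  exact D.hasCell_yMap _

/-- The unit on `E` itself then serves as the cokernel, and the canonical comparison is the
identity. -/
lemma isCover_of_isExtension {D : DoubleCat.{w, z} C} {A E : C} {e : A ⟶ E}
    (h : D.IsExtension (D.yMap e)) : D.IsCover e :=
  ⟨_, D.yMap e, 𝟙 _, h, by simp, by simp, by simp, by simp, Category.comp_id _, inferInstance⟩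

lemma isInclusion_of_isRestriction {D : DoubleCat.{w, z} C} {E B : C} {i : E ⟶ B}
    (h : D.IsRestriction (D.yMap i)) : D.IsInclusion i :=
  ⟨_, D.yMap i, 𝟙 _, h, by simp, by simp, by simp, by simp, Category.id_comp _, inferInstance⟩

/-- The legs of a relation are jointly monic. -/
lemma IsRelation.hom_ext {D : DoubleCat.{w, z} C} (hD : D.IsUnitPure) {R A B Z : C} {l : R ⟶ A}
    {r : R ⟶ B} (h : D.IsRelation l r) {f g : Z ⟶ R} (hl : f ≫ l = g ≫ l)
    (hr : f ≫ r = g ≫ r) : f = g := by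
  obtain ⟨c, hc, hi⟩ := h
  have := hD.mono_of_isInclusion hi
  rw [← cancel_mono (hc.lift (BinaryFan.mk l r))]
  apply BinaryFan.IsLimit.hom_ext hc
  · have := hc.fac (BinaryFan.mk l r) ⟨.left⟩
    simp only [Category.assoc]
    erw [this]
    exact hl
  · have := hc.fac (BinaryFan.mk l r) ⟨.right⟩
    simp only [Category.assoc]
    erw [this]
    exact hr

/-- The counit of the adjunction at `m` is the required universal arrow. -/
lemma HasTabulators.exists_isTabulator {D : DoubleCat.{w, z} C} (hD : D.HasTabulators) {A B : C}
    (m : D.Pro A B) :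
    ∃ (T : C) (τ : ProTotal.of (D.y T) ⟶ ProTotal.of m), D.IsTabulator τ := by
  have : D.unitFunctor.IsLeftAdjoint := hD
  let adj := Adjunction.ofIsLeftAdjoint D.unitFunctor
  refine ⟨_, adj.counit.app (ProTotal.of m), fun {X} θ => ?_⟩
  refine ⟨adj.homEquiv X _ θ, (adj.homEquiv_counit _ _ _).symm.trans
    ((adj.homEquiv X _).symm_apply_apply θ), fun v hv => ?_⟩
  rw [← hv]
  exact ((adj.homEquiv_apply_eq _ _).2 (adj.homEquiv_counit _ _ _).symm).symm

/-- The right adjoint of `D → 1` picks out an object into which maps correspond to maps in the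
one-arrow category. -/
lemma IsCartesian.hasTerminal {D : DoubleCat.{w, z} C} (hD : D.IsCartesian) : HasTerminal C := by
  obtain ⟨-, G, adj, -, -⟩ := hD
  have (X : C) : Unique (X ⟶ G.obj ⟨⟨⟩⟩) :=
    { default := adj.homEquiv X _ (eqToHom (Subsingleton.elim _ _))
      uniq := fun f => (adj.homEquiv X _).symm.injective (Subsingleton.elim _ _) }
  exact hasTerminal_of_unique (G.obj ⟨⟨⟩⟩)

/-- The hypotheses under which a double category turns out to be a double category of relations. -/
structure IsRelational (D : DoubleCat.{w, z} C) : Prop where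
  unitPure : D.IsUnitPure
  hasTerminal : HasTerminal C
  equipment : D.IsEquipment
  tabulators : D.HasTabulators
  strong : D.TabulatorsStrong
  discrete : D.TabulatorsDiscrete
  functorial : D.TabulatorsFunctorial
  relations : D.RelationsAreTabulators

/-! ### Flatness, and cells as morphisms of spans between tabulators. -/

namespace IsRelational

variable {D : DoubleCat.{w, z} C}

lemma tabulator_hom_ext (hD : D.IsRelational) {A B T Z : C} {m : D.Pro A B}
    {τ : ProTotal.of (D.y T) ⟶ ProTotal.of m} (hτ : D.IsTabulator τ) {f g : Z ⟶ T}
    (hl : f ≫ D.sMap τ = g ≫ D.sMap τ) (hr : f ≫ D.tMap τ = g ≫ D.tMap τ) : f = g :=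
  (hD.discrete τ hτ).hom_ext hD.unitPure hl hr

/-- Cells are determined by their vertical boundary. -/
lemma cell_ext (hD : D.IsRelational) {A B A' B' : C} {m : D.Pro A B} {n : D.Pro A' B'}
    {α β : ProTotal.of m ⟶ ProTotal.of n} (hs : D.sMap α = D.sMap β)
    (ht : D.tMap α = D.tMap β) : α = β := by
  obtain ⟨T, τ, hτ⟩ := hD.tabulators.exists_isTabulator m
  obtain ⟨S, σ, hσ⟩ := hD.tabulators.exists_isTabulator n
  obtain ⟨f, hf, -⟩ := hσ (τ ≫ α)
  obtain ⟨g, hg, -⟩ := hσ (τ ≫ β)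
  -- Discreteness: maps into the tabulator of `n` are determined by the legs, and these depend only
  -- on the boundaries of `α` and `β`.
  have hfg : f = g := by
    apply hD.tabulator_hom_ext hσ
    · have h₁ := congrArg D.sMap hf
      have h₂ := congrArg D.sMap hg
      simp only [sMap_comp, sMap_yMap] at h₁ h₂
      rw [h₁, h₂, hs]
    · have h₁ := congrArg D.tMap hf
      have h₂ := congrArg D.tMap hg
      simp only [tMap_comp, tMap_yMap] at h₁ h₂
      rw [h₁, h₂, ht]
  have h : τ ≫ α = τ ≫ β := by rw [← hf, ← hg, hfg]
  -- Strength: `τ` is opcartesian, so cells with the same boundary that agree after precomposition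
  -- with it are equal.
  exact (hD.strong τ hτ n (τ ≫ α) (D.sMap α) (D.tMap α) (by simp) (by simp)).unique
    ⟨rfl, rfl, rfl⟩ ⟨hs.symm, ht.symm, h.symm⟩

/-- A cell whose domain is a unit factors through the tabulator of its codomain. -/
lemma exists_lift {A B T X : C} {m : D.Pro A B}
    {τ : ProTotal.of (D.y T) ⟶ ProTotal.of m} (hτ : D.IsTabulator τ) {f : X ⟶ A} {g : X ⟶ B}
    (h : D.HasCell (D.y X) m f g) : ∃ k : X ⟶ T, k ≫ D.sMap τ = f ∧ k ≫ D.tMap τ = g := by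
  obtain ⟨θ, rfl, rfl⟩ := h
  obtain ⟨k, hk, -⟩ := hτ θ
  exact ⟨k, by simp [← hk], by simp [← hk]⟩

lemma hasCell_of_lift {A B T X : C} {m : D.Pro A B}
    (τ : ProTotal.of (D.y T) ⟶ ProTotal.of m) {f : X ⟶ A} {g : X ⟶ B} (k : X ⟶ T)
    (hf : k ≫ D.sMap τ = f) (hg : k ≫ D.tMap τ = g) : D.HasCell (D.y X) m f g :=
  ⟨D.yMap k ≫ τ, by simpa using hf, by simpa using hg⟩

/-- Cells out of a proarrow correspond to cells out of the unit on its tabulator. -/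
lemma hasCell_of_tabulator (hD : D.IsRelational) {A B T X Y : C} {m : D.Pro A B}
    {τ : ProTotal.of (D.y T) ⟶ ProTotal.of m} (hτ : D.IsTabulator τ) {n : D.Pro X Y}
    {f : A ⟶ X} {g : B ⟶ Y} (h : D.HasCell (D.y T) n (D.sMap τ ≫ f) (D.tMap τ ≫ g)) :
    D.HasCell m n f g :=
  IsExtension.hasCell (hD.strong τ hτ) h

/-- Morphisms of spans between tabulators induce cells. -/
lemma hasCell_of_spanMap (hD : D.IsRelational) {A B T X Y S : C} {m : D.Pro A B}
    {τ : ProTotal.of (D.y T) ⟶ ProTotal.of m} (hτ : D.IsTabulator τ) {n : D.Pro X Y}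
    (σ : ProTotal.of (D.y S) ⟶ ProTotal.of n) {f : A ⟶ X} {g : B ⟶ Y} (k : T ⟶ S)
    (hf : k ≫ D.sMap σ = D.sMap τ ≫ f) (hg : k ≫ D.tMap σ = D.tMap τ ≫ g) :
    D.HasCell m n f g :=
  hD.hasCell_of_tabulator hτ (hasCell_of_lift σ k hf hg)

/-- Cells induce morphisms of spans between tabulators. -/
lemma exists_spanMap {A B T X Y S : C} {m : D.Pro A B}
    (τ : ProTotal.of (D.y T) ⟶ ProTotal.of m) {n : D.Pro X Y}
    {σ : ProTotal.of (D.y S) ⟶ ProTotal.of n} (hσ : D.IsTabulator σ) {f : A ⟶ X} {g : B ⟶ Y}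
    (h : D.HasCell m n f g) :
    ∃ k : T ⟶ S, k ≫ D.sMap σ = D.sMap τ ≫ f ∧ k ≫ D.tMap σ = D.tMap τ ≫ g :=
  exists_lift hσ (HasCell.comp ⟨τ, rfl, rfl⟩ h)

/-! ### Monomorphisms, inclusions and covers. -/

lemma isInclusion_of_mono (hD : D.IsRelational) {E B : C} (i : E ⟶ B) [Mono i] :
    D.IsInclusion i := by
  refine isInclusion_of_isRestriction fun {X Y} p δ h k hs ht => ?_
  obtain ⟨T, τ, hτ⟩ := hD.tabulators.exists_isTabulator p
  -- The cell `τ ≫ δ` runs between units, so its boundary arrows agree by unit-purity and `i` can be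
  -- cancelled. The unit cell of the common arrow then descends from the tabulator to `p`.
  have hT : D.sMap τ ≫ h = D.tMap τ ≫ k := by
    rw [← cancel_mono i]
    simpa [hs, ht] using hD.unitPure.sMap_eq_tMap (τ ≫ δ)
  have : D.HasCell p (D.y E) h k :=
    hD.hasCell_of_tabulator hτ (by rw [← hT]; exact D.hasCell_yMap _)
  obtain ⟨γ, hγs, hγt⟩ := this
  refine ⟨γ, ⟨hγs, hγt, hD.cell_ext (by simp [hγs, hs]) (by simp [hγt, ht])⟩, ?_⟩
  rintro γ' ⟨h₁, h₂, -⟩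
  exact hD.cell_ext (h₁.trans hγs.symm) (h₂.trans hγt.symm)

/-- A monomorphism is the left leg of the tabulator of a proarrow into the terminal object. -/
lemma exists_isTabulator_of_mono (hD : D.IsRelational) [HasTerminal C] {E B : C} (i : E ⟶ B)
    [Mono i] :
    ∃ (m : D.Pro B (⊤_ C)) (τ : ProTotal.of (D.y E) ⟶ ProTotal.of m),
      D.IsTabulator τ ∧ D.sMap τ = i := by
  -- With `B` itself as the product of `B` and the terminal object, the pairing of `i` with the map
  -- to the terminal object is `i`, so the span is a relation.
  let c : BinaryFan B (⊤_ C) := BinaryFan.mk (𝟙 B) (terminal.from B)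
  have hc : IsLimit c := BinaryFan.isLimitMk (fun s => s.fst) (fun s => Category.comp_id _)
    (fun s => Subsingleton.elim _ _) (fun s m h _ => by simpa [c] using h)
  have hi : hc.lift (BinaryFan.mk i (terminal.from E)) = i := by
    have := hc.fac (BinaryFan.mk i (terminal.from E)) ⟨.left⟩
    simpa [c] using this
  obtain ⟨m, τ, hτ, h, -⟩ := hD.relations i (terminal.from E)
    ⟨c, hc, by rw [hi]; exact hD.isInclusion_of_mono i⟩
  exact ⟨m, τ, hτ, h⟩

/-- Covers have the lifting property against monomorphisms. -/
lemma cover_lift (hD : D.IsRelational) {X Y A B : C} {e : X ⟶ Y} (he : D.IsCover e) (i : A ⟶ B)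
    [Mono i] (a : X ⟶ A) (b : Y ⟶ B) (h : e ≫ b = a ≫ i) :
    ∃ d : Y ⟶ A, e ≫ d = a ∧ d ≫ i = b := by
  have := hD.hasTerminal
  obtain ⟨m, τ, hτ, rfl⟩ := hD.exists_isTabulator_of_mono i
  -- The map `a` is a cell from the unit on `X` whose left boundary is `e ≫ b`. It descends along
  -- the cover to the unit on `Y`, and so factors through the tabulator.
  obtain ⟨d, hd, -⟩ := exists_lift hτ (f := b) (g := terminal.from Y)
    (he.hasCell (hasCell_of_lift τ a h.symm (Subsingleton.elim _ _)))
  exact ⟨d, by rw [← cancel_mono (D.sMap τ), Category.assoc, hd, h], hd⟩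

/-- By flatness, `e` is a cover as soon as boundaries of cells descend along it. -/
lemma isCover_of_hasCell (hD : D.IsRelational) {X Y : C} (e : X ⟶ Y)
    (H : ∀ {A B : C} (p : D.Pro A B) (f : Y ⟶ A) (g : Y ⟶ B),
      D.HasCell (D.y X) p (e ≫ f) (e ≫ g) → D.HasCell (D.y Y) p f g) : D.IsCover e := by
  refine isCover_of_isExtension fun {A B} p δ f g hs ht => ?_
  simp only [sMap_yMap, tMap_yMap] at hs ht
  obtain ⟨γ, hγs, hγt⟩ := H p f g ⟨δ, hs, ht⟩
  refine ⟨γ, ⟨hγs, hγt, hD.cell_ext (by simp [hγs, hs]) (by simp [hγt, ht])⟩, ?_⟩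
  rintro γ' ⟨h₁, h₂, -⟩
  exact hD.cell_ext (h₁.trans hγs.symm) (h₂.trans hγt.symm)

lemma isCover_comp (hD : D.IsRelational) {X Y Z : C} {f : X ⟶ Y} {g : Y ⟶ Z} (hf : D.IsCover f)
    (hg : D.IsCover g) : D.IsCover (f ≫ g) :=
  hD.isCover_of_hasCell _ fun _ _ _ h => hg.hasCell (hf.hasCell (by simpa using h))

lemma isCover_of_isIso (hD : D.IsRelational) {X Y : C} (f : X ⟶ Y) [IsIso f] : D.IsCover f :=
  hD.isCover_of_hasCell f fun _ _ _ h => by simpa using (D.hasCell_yMap (inv f)).comp h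

/-- A morphism with the lifting property against monomorphisms is a cover. -/
lemma isCover_of_lift (hD : D.IsRelational) {X Y : C} (e : X ⟶ Y)
    (H : ∀ {A B Z : C} (l : Z ⟶ A) (r : Z ⟶ B), D.IsRelation l r →
      ∀ (a : X ⟶ Z) (f : Y ⟶ A) (g : Y ⟶ B), e ≫ f = a ≫ l → e ≫ g = a ≫ r →
        ∃ d : Y ⟶ Z, d ≫ l = f ∧ d ≫ r = g) : D.IsCover e := by
  refine hD.isCover_of_hasCell e fun p f g h => ?_
  obtain ⟨T, τ, hτ⟩ := hD.tabulators.exists_isTabulator p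
  obtain ⟨a, ha₁, ha₂⟩ := exists_lift hτ h
  obtain ⟨d, hd₁, hd₂⟩ := H _ _ (hD.discrete τ hτ) a f g ha₁.symm ha₂.symm
  exact hasCell_of_lift τ d hd₁ hd₂

/-! ### Finite limits -/

lemma hasCell_companion {A B : C} {f : A ⟶ B} (c : D.Companion f) :
    D.HasCell (D.y A) c.pro (𝟙 A) f :=
  ⟨c.eta, c.sMap_eta, c.tMap_eta⟩

lemma hasCell_conjoint {A B : C} {f : A ⟶ B} (c : D.Conjoint f) :
    D.HasCell (D.y A) c.pro f (𝟙 A) :=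
  ⟨c.eta, c.sMap_eta, c.tMap_eta⟩

/-- The kernel proarrow of a cospan classifies the commutative squares over it. -/
lemma hasCell_kernel_iff (hD : D.IsRelational) {A B X Z : C} {f : A ⟶ X} {g : B ⟶ X}
    (fl : D.Companion f) (gu : D.Conjoint g) (h : Z ⟶ A) (k : Z ⟶ B) :
    D.HasCell (D.y Z) (D.tens fl.pro gu.pro) h k ↔ h ≫ f = k ≫ g := by
  constructor
  · intro H
    -- Composing with the counits of companion and conjoint gives a cell between units with boundary
    -- `(h ≫ f, k ≫ g)`; unit-purity applies.
    have h₁ : D.HasCell fl.pro (D.y X) f (𝟙 X) := ⟨fl.eps, fl.sMap_eps, fl.tMap_eps⟩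
    have h₂ : D.HasCell gu.pro (D.y X) (𝟙 X) g := ⟨gu.eps, gu.sMap_eps, gu.tMap_eps⟩
    have := H.comp ((h₁.tens h₂).comp (D.hasCell_lam (D.y X)))
    exact hD.unitPure.eq_of_hasCell (by simpa using this)
  · intro H
    -- The two unit cells have inner boundaries `h ≫ f` and `k ≫ g`; commutativity of the square is
    -- what allows them to be composed externally.
    have h₁ := (D.hasCell_yMap h).comp (hasCell_companion fl)
    have h₂ := (D.hasCell_yMap k).comp (hasCell_conjoint gu)
    rw [← H] at h₂
    simpa using h₁.unitTens h₂

/-- The tabulator of the kernel proarrow of a cospan is its pullback. -/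
lemma isPullback_of_isTabulator (hD : D.IsRelational) {A B X T : C} {f : A ⟶ X} {g : B ⟶ X}
    (fl : D.Companion f) (gu : D.Conjoint g)
    {τ : ProTotal.of (D.y T) ⟶ ProTotal.of (D.tens fl.pro gu.pro)} (hτ : D.IsTabulator τ) :
    IsPullback (D.sMap τ) (D.tMap τ) f g := by
  have w := (hD.hasCell_kernel_iff fl gu _ _).1 ⟨τ, rfl, rfl⟩
  have H (s : PullbackCone f g) :=
    exists_lift hτ ((hD.hasCell_kernel_iff fl gu _ _).2 s.condition)
  exact ⟨⟨w⟩, ⟨PullbackCone.IsLimit.mk w (fun s => (H s).choose)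
    (fun s => (H s).choose_spec.1) (fun s => (H s).choose_spec.2)
    (fun s m h₁ h₂ => hD.tabulator_hom_ext hτ (h₁.trans (H s).choose_spec.1.symm)
      (h₂.trans (H s).choose_spec.2.symm))⟩⟩

/-- A terminal object and pullbacks suffice, and the pullbacks are tabulators of kernel proarrows.
-/
lemma hasFiniteLimits (hD : D.IsRelational) : HasFiniteLimits C := by
  have := hD.hasTerminal
  have : HasPullbacks C := by
    suffices ∀ {A B X : C} (f : A ⟶ X) (g : B ⟶ X), HasPullback f g by
      have (A B X : C) (f : A ⟶ X) (g : B ⟶ X) : HasLimit (cospan f g) := this f g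
      exact hasPullbacks_of_hasLimit_cospan C
    intro A B X f g
    obtain ⟨fl⟩ := (hD.equipment f).1
    obtain ⟨gu⟩ := (hD.equipment g).2
    obtain ⟨T, τ, hτ⟩ := hD.tabulators.exists_isTabulator (D.tens fl.pro gu.pro)
    exact (hD.isPullback_of_isTabulator fl gu hτ).hasPullback
  exact hasFiniteLimits_of_hasTerminal_and_pullbacks

/-- The kernel proarrow of a cospan is the extension of the unit along any pullback of it. -/
lemma hasCell_kernel (hD : D.IsRelational) {A B X P Y Z : C} {f : A ⟶ X} {g : B ⟶ X}
    (fl : D.Companion f) (gu : D.Conjoint g) {a : P ⟶ A} {b : P ⟶ B} (sq : IsPullback a b f g)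
    {n : D.Pro Y Z} {h : A ⟶ Y} {k : B ⟶ Z} (H : D.HasCell (D.y P) n (a ≫ h) (b ≫ k)) :
    D.HasCell (D.tens fl.pro gu.pro) n h k := by
  obtain ⟨T, τ, hτ⟩ := hD.tabulators.exists_isTabulator (D.tens fl.pro gu.pro)
  have sq' := hD.isPullback_of_isTabulator fl gu hτ
  refine hD.hasCell_of_tabulator hτ ?_
  have := (D.hasCell_yMap (sq.lift _ _ sq'.w)).comp H
  simpa using this

/-! ### The factorization system -/

/-- The collage `f^* ⊗ g_!` is an extension of the unit along `(f, g)`. -/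
lemma hasCell_collage {A B X Y Z : C} {f : X ⟶ A} {g : X ⟶ B} (fu : D.Conjoint f)
    (gl : D.Companion g) {n : D.Pro Y Z} {h : A ⟶ Y} {k : B ⟶ Z}
    (H : D.HasCell (D.y X) n (f ≫ h) (g ≫ k)) : D.HasCell (D.tens fu.pro gl.pro) n h k := by
  have h₁ : D.HasCell fu.pro (D.y A) (𝟙 A) f := ⟨fu.eps, fu.sMap_eps, fu.tMap_eps⟩
  have h₂ : D.HasCell gl.pro (D.y B) g (𝟙 B) := ⟨gl.eps, gl.sMap_eps, gl.tMap_eps⟩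
  -- The given cell is inserted as the middle factor of `(f^* ⊗ y_X) ⊗ g_!`, flanked by the counits
  -- of `f^*` and `g_!` followed by the units of `h` and `k`; the outer factors then become units
  -- and are absorbed by the unitors.
  have h₃ := (((h₁.comp (D.hasCell_yMap h)).tens H).comp (D.hasCell_lam n)).tens
    (k := k) (by simpa using h₂.comp (D.hasCell_yMap k))
  simpa using ((D.hasCell_rho_inv fu.pro).tens (D.hasCell_refl gl.pro)).comp
    (h₃.comp (D.hasCell_rho n))

/-- The image is the tabulator of the collage of `f` and the map to the terminal object. If `f`
factors through a subobject of `Y`, tabulating some `n`, the resulting cell from the unit on `X`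
descends to the collage, so the image is contained in that subobject. This minimality makes `e` a
cover. -/
lemma exists_factorization (hD : D.IsRelational) {X Y : C} (f : X ⟶ Y) :
    ∃ (I : C) (e : X ⟶ I) (i : I ⟶ Y), D.IsCover e ∧ Mono i ∧ e ≫ i = f := by
  have := hD.hasFiniteLimits
  obtain ⟨fu⟩ := (hD.equipment f).2
  obtain ⟨tl⟩ := (hD.equipment (terminal.from X)).1
  obtain ⟨T, τ, hτ⟩ := hD.tabulators.exists_isTabulator (D.tens fu.pro tl.pro)
  obtain ⟨e, he, -⟩ := exists_lift hτ ((hasCell_conjoint fu).unitTens (hasCell_companion tl))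
  -- The right leg ends at the terminal object, so joint monicity of the legs falls on the left one.
  have : Mono (D.sMap τ) :=
    ⟨fun g h w => hD.tabulator_hom_ext hτ w (Subsingleton.elim _ _)⟩
  refine ⟨T, e, D.sMap τ, hD.isCover_of_lift e ?_, this, he⟩
  intro A B Z l r hlr a f' g' hf hg
  have : Mono (prod.lift l r) := ⟨fun u v w => hlr.hom_ext hD.unitPure
    (by simpa only [Category.assoc, prod.lift_fst] using congrArg (· ≫ prod.fst) w) (by simpa only [Category.assoc, prod.lift_snd] using congrArg (· ≫ prod.snd) w)⟩
  -- The relation is pulled back to a subobject `s` of the image `T`. Since `X` maps into it over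
  -- `Y`, minimality of `T` gives a section of `s`, which yields the required lift.
  let s := pullback.fst (prod.lift f' g') (prod.lift l r)
  obtain ⟨n, σ, hσ, hs⟩ := hD.exists_isTabulator_of_mono (s ≫ D.sMap τ)
  have hX : D.HasCell (D.y X) n (f ≫ 𝟙 Y) (terminal.from X ≫ 𝟙 _) := by
    refine hasCell_of_lift σ (pullback.lift e a ?_) ?_ (Subsingleton.elim _ _)
    · ext <;> simp [hf, hg]
    · rw [hs, pullback.lift_fst_assoc, he, Category.comp_id]
  obtain ⟨d, hd, -⟩ := exists_spanMap τ hσ (hasCell_collage fu tl hX)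
  have hds : d ≫ s = 𝟙 T := by
    rw [← cancel_mono (D.sMap τ), Category.assoc, ← hs, hd, Category.comp_id, Category.id_comp]
  have h₁ : d ≫ pullback.snd (prod.lift f' g') (prod.lift l r) ≫ prod.lift l r =
      prod.lift f' g' := by
    rw [← pullback.condition, ← Category.assoc]
    exact (congrArg (· ≫ prod.lift f' g') hds).trans (Category.id_comp _)
  refine ⟨d ≫ pullback.snd _ _, ?_, ?_⟩
  · simpa only [Category.assoc, prod.lift_fst] using congrArg (· ≫ prod.fst) h₁
  · simpa only [Category.assoc, prod.lift_snd] using congrArg (· ≫ prod.snd) h₁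

/-- Covers are stable under pullback. -/
lemma isCover_of_isPullback (hD : D.IsRelational) {P A B X : C} {d : P ⟶ A} {c : P ⟶ B}
    {h : A ⟶ X} {e : B ⟶ X} (sq : IsPullback d c h e) (he : D.IsCover e) : D.IsCover d := by
  have := hD.hasTerminal
  obtain ⟨I, q, i, hq, hi, rfl⟩ := hD.exists_factorization d
  obtain ⟨s, τ, hτ, rfl⟩ := hD.exists_isTabulator_of_mono i
  obtain ⟨hl⟩ := (hD.equipment h).1
  obtain ⟨el⟩ := (hD.equipment e).1
  obtain ⟨eu⟩ := (hD.equipment e).2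
  -- It remains to show that the image of `d`, a subobject of `A` tabulating `s`, is all of `A`. The
  -- map `q` gives a cell from the unit on `P`, which descends to the kernel `h_! ⊗ e^*`.
  have h₁ : D.HasCell (D.tens hl.pro eu.pro) s (𝟙 A) (terminal.from B) :=
    hD.hasCell_kernel hl eu sq
      (hasCell_of_lift τ q (Category.comp_id _).symm (Subsingleton.elim _ _))
  -- This is where the cover hypothesis enters: the unit on `X` maps to the collage `e^* ⊗ e_!`.
  have h₂ : D.HasCell (D.y X) (D.tens eu.pro el.pro) (𝟙 X) (𝟙 X) :=
    he.hasCell (by simpa using (hasCell_conjoint eu).unitTens (hasCell_companion el))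
  have h₃ : D.HasCell el.pro (D.y (⊤_ C)) (terminal.from B) (terminal.from X) := by
    have : D.HasCell el.pro (D.y X) e (𝟙 X) := ⟨el.eps, el.sMap_eps, el.tMap_eps⟩
    simpa using this.comp (D.hasCell_yMap (terminal.from X))
  -- The chain is `y_A ⇒ h_! ⇒ h_! ⊗ (e^* ⊗ e_!) ⇒ (h_! ⊗ e^*) ⊗ e_! ⇒ s ⊗ y_1 ⇒ s`.
  have h₄ : D.HasCell (D.y A) s (𝟙 A) (terminal.from A) := by
    have := (hasCell_companion hl).comp ((D.hasCell_rho_inv hl.pro).comp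
      (((D.hasCell_refl hl.pro).tens h₂).comp ((D.hasCell_assoc_inv _ _ _).comp
        ((h₁.tens h₃).comp (D.hasCell_rho s)))))
    simpa using this
  obtain ⟨k, hk, -⟩ := exists_lift hτ h₄
  -- A monomorphism with a section is invertible.
  have : IsIso (D.sMap τ) := ⟨k, by rw [← cancel_mono (D.sMap τ), Category.assoc, hk]; simp, hk⟩
  exact hD.isCover_comp hq (hD.isCover_of_isIso _)

/-- Since inclusions coincide with monomorphisms, their closure properties and the uniqueness of
diagonal fillers are immediate. -/
lemma isProperStableFactorizationSystem (hD : D.IsRelational) :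
    IsProperStableFactorizationSystem D.covers D.inclusions where
  iso_left f _ := hD.isCover_of_isIso f
  iso_right f _ := hD.isInclusion_of_mono f
  comp_left f g hf hg := hD.isCover_comp hf hg
  comp_right f g hf hg := by
    have := hD.unitPure.mono_of_isInclusion hf
    have := hD.unitPure.mono_of_isInclusion hg
    exact hD.isInclusion_of_mono (f ≫ g)
  fact f := by
    obtain ⟨I, e, i, he, hi, h⟩ := hD.exists_factorization f
    exact ⟨I, e, i, he, hD.isInclusion_of_mono i, h⟩
  lift e i a b he hi h := by
    have := hD.unitPure.mono_of_isInclusion hi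
    obtain ⟨d, hd⟩ := hD.cover_lift he i a b h
    exact ⟨d, hd, fun d' hd' => by rw [← cancel_mono i, hd.2, hd'.2]⟩
  epi f hf := hD.unitPure.epi_of_isCover hf
  mono f hf := hD.unitPure.mono_of_isInclusion hf
  stable sq he := hD.isCover_of_isPullback sq he

end IsRelational

end DoubleCat

/-! ### Double functors into flat double categories -/

namespace DoubleCat

variable {C : Type u} [Category.{v} C]

/-- A chosen cell with the given boundary. -/
noncomputable def HasCell.cell {D : DoubleCat.{w, z} C} {A B A' B' : C} {m : D.Pro A B}
    {n : D.Pro A' B'} {f : A ⟶ A'} {g : B ⟶ B'} (h : D.HasCell m n f g) :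
    ProTotal.of m ⟶ ProTotal.of n :=
  h.choose

@[simp]
lemma HasCell.sMap_cell {D : DoubleCat.{w, z} C} {A B A' B' : C} {m : D.Pro A B}
    {n : D.Pro A' B'} {f : A ⟶ A'} {g : B ⟶ B'} (h : D.HasCell m n f g) : D.sMap h.cell = f :=
  h.choose_spec.1

@[simp]
lemma HasCell.tMap_cell {D : DoubleCat.{w, z} C} {A B A' B' : C} {m : D.Pro A B}
    {n : D.Pro A' B'} {f : A ⟶ A'} {g : B ⟶ B'} (h : D.HasCell m n f g) : D.tMap h.cell = g :=
  h.choose_spec.2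

/-- Cells are determined by their vertical boundary. -/
structure IsFlat (D : DoubleCat.{w, z} C) : Prop where
  ext {A B A' B' : C} {m : D.Pro A B} {n : D.Pro A' B'} (α β : ProTotal.of m ⟶ ProTotal.of n) :
    D.sMap α = D.sMap β → D.tMap α = D.tMap β → α = β

/-- Opposite globular cells in a flat double category are mutually inverse. -/
noncomputable def IsFlat.iso {D : DoubleCat.{w, z} C} (hD : D.IsFlat) {A B : C}
    {m n : D.Pro A B} (h : D.HasCell m n (𝟙 A) (𝟙 B)) (h' : D.HasCell n m (𝟙 A) (𝟙 B)) :
    ProTotal.of m ≅ ProTotal.of n where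
  hom := h.cell
  inv := h'.cell
  hom_inv_id := hD.ext _ _ (by simp) (by simp)
  inv_hom_id := hD.ext _ _ (by simp) (by simp)

@[simp]
lemma IsFlat.sMap_iso_hom {D : DoubleCat.{w, z} C} (hD : D.IsFlat) {A B : C}
    {m n : D.Pro A B} (h : D.HasCell m n (𝟙 A) (𝟙 B)) (h' : D.HasCell n m (𝟙 A) (𝟙 B)) :
    D.sMap (hD.iso h h').hom = 𝟙 A :=
  h.sMap_cell

@[simp]
lemma IsFlat.tMap_iso_hom {D : DoubleCat.{w, z} C} (hD : D.IsFlat) {A B : C}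
    {m n : D.Pro A B} (h : D.HasCell m n (𝟙 A) (𝟙 B)) (h' : D.HasCell n m (𝟙 A) (𝟙 B)) :
    D.tMap (hD.iso h h').hom = 𝟙 B :=
  h.tMap_cell

/-- A double functor over the identity into a flat double category, given by its values on
proarrows and the existence of the required cells. -/
noncomputable def IsFlat.functor {D : DoubleCat.{w, z} C} {D' : DoubleCat.{w', z'} C}
    (hD' : D'.IsFlat) (obj : ∀ {A B : C}, D.Pro A B → D'.Pro A B)
    (map : ∀ {A B A' B' : C} {m : D.Pro A B} {n : D.Pro A' B'} {f : A ⟶ A'} {g : B ⟶ B'},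
      D.HasCell m n f g → D'.HasCell (obj m) (obj n) f g)
    (mu : ∀ {A B E : C} (m : D.Pro A B) (n : D.Pro B E),
      D'.HasCell (D'.tens (obj m) (obj n)) (obj (D.tens m n)) (𝟙 A) (𝟙 E))
    (mu' : ∀ {A B E : C} (m : D.Pro A B) (n : D.Pro B E),
      D'.HasCell (obj (D.tens m n)) (D'.tens (obj m) (obj n)) (𝟙 A) (𝟙 E))
    (unit : ∀ A : C, D'.HasCell (D'.y A) (obj (D.y A)) (𝟙 A) (𝟙 A))
    (unit' : ∀ A : C, D'.HasCell (obj (D.y A)) (D'.y A) (𝟙 A) (𝟙 A)) :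
    DoubleFunctor (𝟭 C) D D' where
  obj := obj
  map α := (map ⟨α, rfl, rfl⟩).cell
  sMap_map α := HasCell.sMap_cell _
  tMap_map α := HasCell.tMap_cell _
  map_id m := hD'.ext _ _ (by simp) (by simp)
  map_comp α β := hD'.ext _ _ (by simp) (by simp)
  mu m n := hD'.iso (mu m n) (mu' m n)
  sMap_mu m n := hD'.sMap_iso_hom _ _
  tMap_mu m n := hD'.tMap_iso_hom _ _
  mu_naturality α β h := hD'.ext _ _ (by simp) (by simp)
  unit A := hD'.iso (unit A) (unit' A)
  sMap_unit A := hD'.sMap_iso_hom _ _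
  tMap_unit A := hD'.tMap_iso_hom _ _
  unit_naturality f := hD'.ext _ _ (by simp) (by simp)
  map_assoc m n p := hD'.ext _ _ (by simp) (by simp)
  map_lam m := hD'.ext _ _ (by simp) (by simp)
  map_rho m := hD'.ext _ _ (by simp) (by simp)

/-- A vertical transformation into a flat double category amounts to the existence of cells. -/
noncomputable def IsFlat.verticalTrans {C' : Type u'} [Category.{v'} C'] {F₀ G₀ : C ⥤ C'}
    {D : DoubleCat.{w, z} C} {D' : DoubleCat.{w', z'} C'} (hD' : D'.IsFlat) (t : F₀ ⟶ G₀)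
    (F : DoubleFunctor F₀ D D') (G : DoubleFunctor G₀ D D')
    (h : ∀ {A B : C} (m : D.Pro A B), D'.HasCell (F.obj m) (G.obj m) (t.app A) (t.app B)) :
    VerticalTrans t F G where
  app m := (h m).cell
  sMap_app m := (h m).sMap_cell
  tMap_app m := (h m).tMap_cell
  naturality α := hD'.ext _ _ (by simp) (by simp)
  app_tens m n := hD'.ext _ _ (by simp) (by simp)
  app_y A := hD'.ext _ _ (by simp) (by simp)

/-- In an adjunction between flat double categories the triangle identities are automatic. -/
def IsFlat.adjunction {C' : Type u'} [Category.{v'} C'] {F₀ : C ⥤ C'} {G₀ : C' ⥤ C}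
    {D : DoubleCat.{w, z} C} {D' : DoubleCat.{w', z'} C'} (hD : D.IsFlat) (hD' : D'.IsFlat)
    (adj : F₀ ⊣ G₀) {F : DoubleFunctor F₀ D D'} {G : DoubleFunctor G₀ D' D}
    (unit : VerticalTrans adj.unit (DoubleFunctor.id D) (F.comp G))
    (counit : VerticalTrans adj.counit (G.comp F) (DoubleFunctor.id D')) :
    DoubleAdjunction adj F G where
  unit := unit
  counit := counit
  -- On boundaries the equation is the triangle identity of `adj`; flatness lifts it to cells.
  left_triangle m := hD'.ext _ _
    ((D'.sMap_comp _ _).trans ((congrArg₂ (· ≫ ·) ((F.sMap_map _).trans (congrArg F₀.map (unit.sMap_app m)))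
      (counit.sMap_app (F.obj m))).trans
      ((adj.left_triangle_components _).trans (D'.sMap_id _).symm)))
    ((D'.tMap_comp _ _).trans ((congrArg₂ (· ≫ ·) ((F.tMap_map _).trans (congrArg F₀.map (unit.tMap_app m)))
      (counit.tMap_app (F.obj m))).trans
      ((adj.left_triangle_components _).trans (D'.tMap_id _).symm)))
  right_triangle m := hD.ext _ _
    ((D.sMap_comp _ _).trans ((congrArg₂ (· ≫ ·) (unit.sMap_app (G.obj m))
      ((G.sMap_map _).trans (congrArg G₀.map (counit.sMap_app m)))).trans
      ((adj.right_triangle_components _).trans (D.sMap_id _).symm)))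
    ((D.tMap_comp _ _).trans ((congrArg₂ (· ≫ ·) (unit.tMap_app (G.obj m))
      ((G.tMap_map _).trans (congrArg G₀.map (counit.tMap_app m)))).trans
      ((adj.right_triangle_components _).trans (D.tMap_id _).symm)))

/-- Double functors over the identity between flat double categories that are mutually inverse up
to globular cells form an adjoint equivalence. -/
noncomputable def IsFlat.equivalence {D : DoubleCat.{w, z} C} {D' : DoubleCat.{w', z'} C}
    (hD : D.IsFlat) (hD' : D'.IsFlat) (F : DoubleFunctor (𝟭 C) D D')
    (G : DoubleFunctor (𝟭 C) D' D)
    (η : ∀ {A B : C} (m : D.Pro A B), D.HasCell m (G.obj (F.obj m)) (𝟙 A) (𝟙 B))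
    (η' : ∀ {A B : C} (m : D.Pro A B), D.HasCell (G.obj (F.obj m)) m (𝟙 A) (𝟙 B))
    (ε : ∀ {A B : C} (m : D'.Pro A B), D'.HasCell (F.obj (G.obj m)) m (𝟙 A) (𝟙 B))
    (ε' : ∀ {A B : C} (m : D'.Pro A B), D'.HasCell m (F.obj (G.obj m)) (𝟙 A) (𝟙 B)) :
    DoubleAdjointEquivalence (CategoryTheory.Equivalence.refl (C := C)) D D' where
  functor := F
  inverse := G
  adj := hD.adjunction hD' _
    (hD.verticalTrans (CategoryTheory.Equivalence.refl (C := C)).toAdjunction.unit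
      (DoubleFunctor.id D) (F.comp G) η)
    (hD'.verticalTrans (CategoryTheory.Equivalence.refl (C := C)).toAdjunction.counit
      (G.comp F) (DoubleFunctor.id D') ε)
  isIso_unit m := (hD.iso (η m) (η' m)).isIso_hom
  isIso_counit m := (hD'.iso (ε m) (ε' m)).isIso_hom

end DoubleCat

lemma IsProperStableFactorizationSystem.isFlat_relDouble {C : Type u} [Category.{v} C]
    [HasFiniteLimits C] {E M : MorphismProperty C} (F : IsProperStableFactorizationSystem E M) :
    (RelDouble F).IsFlat :=
  ⟨fun α β hs ht => F.relCell_ext α β hs ht⟩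

/-! ### The equivalence with relations -/

namespace DoubleCat.IsRelational

variable {C : Type u} [Category.{v} C] {D : DoubleCat.{w, z} C}

lemma isFlat (hD : D.IsRelational) : D.IsFlat := ⟨fun _ _ => hD.cell_ext⟩

/-- A chosen tabulator of a proarrow. -/
noncomputable def tabulator (hD : D.IsRelational) {A B : C} (m : D.Pro A B) :
    ProTotal.of (D.y (hD.tabulators.exists_isTabulator m).choose) ⟶ ProTotal.of m :=
  (hD.tabulators.exists_isTabulator m).choose_spec.choose

lemma isTabulator_tabulator (hD : D.IsRelational) {A B : C} (m : D.Pro A B) :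
    D.IsTabulator (hD.tabulator m) :=
  (hD.tabulators.exists_isTabulator m).choose_spec.choose_spec

variable [HasFiniteLimits C]

/-- `IsRelation` accepts any product cone; the chosen product underlying `RelPro` is taken as the
witness. -/
lemma isRelation_of_relPro {A B : C} (R : RelPro D.inclusions A B) : D.IsRelation R.l R.r := by
  refine ⟨_, prodIsProd A B, ?_⟩
  have h : (prodIsProd A B).lift (BinaryFan.mk R.l R.r) = prod.lift R.l R.r := by
    apply prod.hom_ext
    · exact ((prodIsProd A B).fac _ ⟨.left⟩).trans (prod.lift_fst _ _).symm
    · exact ((prodIsProd A B).fac _ ⟨.right⟩).trans (prod.lift_snd _ _).symm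
  rw [h]
  exact R.mem

/-- The relation formed by the legs of a tabulator. -/
abbrev tabulatorRel (hD : D.IsRelational) {A B T : C} {m : D.Pro A B}
    {τ : ProTotal.of (D.y T) ⟶ ProTotal.of m} (hτ : D.IsTabulator τ) :
    RelPro D.inclusions A B where
  apex := T
  l := D.sMap τ
  r := D.tMap τ
  mem := by
    have : Mono (prod.lift (D.sMap τ) (D.tMap τ)) := ⟨fun u v w => hD.tabulator_hom_ext hτ
      (by simpa only [Category.assoc, prod.lift_fst] using congrArg (· ≫ prod.fst) w)
      (by simpa only [Category.assoc, prod.lift_snd] using congrArg (· ≫ prod.snd) w)⟩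
    exact hD.isInclusion_of_mono _

/-- The composite of two relations is the tabulator of the composite of the proarrows which they
tabulate. -/
lemma exists_relComp_iso (hD : D.IsRelational)
    (F : IsProperStableFactorizationSystem D.covers D.inclusions) {A B E T : C}
    (R : RelPro D.inclusions A B) (S : RelPro D.inclusions B E) {p : D.Pro A B} {q : D.Pro B E}
    {τ₁ : ProTotal.of (D.y R.apex) ⟶ ProTotal.of p} {τ₂ : ProTotal.of (D.y S.apex) ⟶ ProTotal.of q}
    {τ : ProTotal.of (D.y T) ⟶ ProTotal.of (D.tens p q)} (hτ₁ : D.IsTabulator τ₁)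
    (hτ₂ : D.IsTabulator τ₂) (hτ : D.IsTabulator τ) (hl₁ : D.sMap τ₁ = R.l)
    (hr₁ : D.tMap τ₁ = R.r) (hl₂ : D.sMap τ₂ = S.l) (hr₂ : D.tMap τ₂ = S.r) :
    ∃ i : (F.relComp R S).apex ≅ T,
      i.hom ≫ D.sMap τ = (F.relComp R S).l ∧ i.hom ≫ D.tMap τ = (F.relComp R S).r := by
  have sq : IsPullback (pullback.fst R.r S.l) (pullback.snd R.r S.l) (D.tMap τ₁) (D.sMap τ₂) := by
    rw [hr₁, hl₂]; exact IsPullback.of_hasPullback _ _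
  have h₁ := hasCell_of_lift τ₁ (pullback.fst R.r S.l) (by rw [hl₁]) (by rw [hr₁])
  have h₂ := hasCell_of_lift τ₂ (pullback.snd R.r S.l) (by rw [hl₂, ← pullback.condition])
    (by rw [hr₂])
  -- The two tabulator cells, restricted to the pullback and composed externally, induce a map from
  -- the pullback to `T`.
  obtain ⟨k, hk₁, hk₂⟩ := exists_lift hτ (h₁.unitTens h₂)
  -- The tabulator `T` is a relation, so `k` descends along the cover onto the image; functoriality
  -- then makes `γ` invertible.
  obtain ⟨γ, hγ, hγ₁, hγ₂⟩ := F.exists_descend (hD.tabulatorRel hτ) (F.relCompE_mem R S) k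
    (F.relComp R S).l (F.relComp R S).r ((F.relCompE_l R S).trans hk₁.symm)
    ((F.relCompE_r R S).trans hk₂.symm)
  have : IsIso γ := by
    refine hD.functorial p q τ₁ τ₂ τ hτ₁ hτ₂ hτ _ _ sq (F.relCompE R S) (F.relComp R S).l
      (F.relComp R S).r (F.relCompE_mem R S) (isRelation_of_relPro _)
      (by rw [F.relCompE_l, hl₁]) (by rw [F.relCompE_r, hr₂]) γ hγ₁ hγ₂ ?_
    -- The compatibility of `γ` with the composed tabulator cells is an equation of cells, so by
    -- flatness only the boundaries need comparing.
    have hs := D.sMap_iso_inv (D.lam (D.y (pullback R.r S.l))) (by simp)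
    have ht := D.tMap_iso_inv (D.lam (D.y (pullback R.r S.l))) (by simp)
    apply hD.cell_ext
    · simp [hγ, hk₁, hl₁, hs]
    · simp [hγ, hk₂, hr₂, ht]
  exact ⟨asIso γ, hγ₁, hγ₂⟩

/-- A relation is the tabulator of a proarrow. -/
lemma exists_isTabulator_of_rel (hD : D.IsRelational) {A B : C} (R : RelPro D.inclusions A B) :
    ∃ (m : D.Pro A B) (τ : ProTotal.of (D.y R.apex) ⟶ ProTotal.of m),
      D.IsTabulator τ ∧ D.sMap τ = R.l ∧ D.tMap τ = R.r :=
  hD.relations R.l R.r (isRelation_of_relPro R)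

/-- The proarrow tabulated by a relation. -/
noncomputable def proOfRel (hD : D.IsRelational) {A B : C} (R : RelPro D.inclusions A B) :
    D.Pro A B :=
  (hD.exists_isTabulator_of_rel R).choose

/-- A tabulator of the proarrow of a relation, with the relation as its legs. -/
noncomputable def tabulatorOfRel (hD : D.IsRelational) {A B : C} (R : RelPro D.inclusions A B) :
    ProTotal.of (D.y R.apex) ⟶ ProTotal.of (hD.proOfRel R) :=
  (hD.exists_isTabulator_of_rel R).choose_spec.choose

lemma isTabulator_tabulatorOfRel (hD : D.IsRelational) {A B : C} (R : RelPro D.inclusions A B) :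
    D.IsTabulator (hD.tabulatorOfRel R) :=
  (hD.exists_isTabulator_of_rel R).choose_spec.choose_spec.1

@[simp]
lemma sMap_tabulatorOfRel (hD : D.IsRelational) {A B : C} (R : RelPro D.inclusions A B) :
    D.sMap (hD.tabulatorOfRel R) = R.l :=
  (hD.exists_isTabulator_of_rel R).choose_spec.choose_spec.2.1

@[simp]
lemma tMap_tabulatorOfRel (hD : D.IsRelational) {A B : C} (R : RelPro D.inclusions A B) :
    D.tMap (hD.tabulatorOfRel R) = R.r :=
  (hD.exists_isTabulator_of_rel R).choose_spec.choose_spec.2.2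

/-- The relation of a proarrow. -/
noncomputable abbrev relOfPro (hD : D.IsRelational) {A B : C} (m : D.Pro A B) :
    RelPro D.inclusions A B :=
  hD.tabulatorRel (hD.isTabulator_tabulator m)

/-! ### From relations to proarrows. -/

lemma hasCell_proOfRel (hD : D.IsRelational) {A B A' B' : C} {R : RelPro D.inclusions A B}
    {S : RelPro D.inclusions A' B'} (α : RelCell R S) :
    D.HasCell (hD.proOfRel R) (hD.proOfRel S) α.left α.right :=
  hD.hasCell_of_spanMap (hD.isTabulator_tabulatorOfRel R) (hD.tabulatorOfRel S) α.apex
    (by simpa using α.comm_l) (by simpa using α.comm_r)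

lemma hasCell_proOfRel_relComp (hD : D.IsRelational)
    (F : IsProperStableFactorizationSystem D.covers D.inclusions) {A B E : C}
    (R : RelPro D.inclusions A B) (S : RelPro D.inclusions B E) :
    D.HasCell (D.tens (hD.proOfRel R) (hD.proOfRel S)) (hD.proOfRel (F.relComp R S))
        (𝟙 A) (𝟙 E) ∧
      D.HasCell (hD.proOfRel (F.relComp R S)) (D.tens (hD.proOfRel R) (hD.proOfRel S))
        (𝟙 A) (𝟙 E) := by
  obtain ⟨i, hl, hr⟩ := hD.exists_relComp_iso F R S (hD.isTabulator_tabulatorOfRel R)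
    (hD.isTabulator_tabulatorOfRel S) (hD.isTabulator_tabulator _) (by simp) (by simp)
    (by simp) (by simp)
  exact ⟨hD.hasCell_of_spanMap (hD.isTabulator_tabulator _) (hD.tabulatorOfRel _) i.inv
      (by simp [← hl]) (by simp [← hr]),
    hD.hasCell_of_spanMap (hD.isTabulator_tabulatorOfRel _) (hD.tabulator _) i.hom
      (by simp [hl]) (by simp [hr])⟩

/-- The double functor sending a relation to the proarrow which it tabulates. -/
noncomputable def relToPro (hD : D.IsRelational)
    (F : IsProperStableFactorizationSystem D.covers D.inclusions) :
    DoubleFunctor (𝟭 C) (RelDouble F) D :=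
  hD.isFlat.functor (D := RelDouble F) (fun R => hD.proOfRel R)
    (by rintro A B A' B' R S f g ⟨α, rfl, rfl⟩; exact hD.hasCell_proOfRel α)
    (fun R S => (hD.hasCell_proOfRel_relComp F R S).1)
    (fun R S => (hD.hasCell_proOfRel_relComp F R S).2)
    -- The legs of the diagonal are identities, so its tabulator cell is already a globular cell
    -- from the unit. Being an extension, it also gives a globular cell back.
    (fun A => hasCell_of_lift (hD.tabulatorOfRel (F.relUnit A)) (𝟙 A) (by simp) (by simp))
    (fun A => hD.hasCell_of_tabulator (hD.isTabulator_tabulatorOfRel (F.relUnit A))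
      (by simpa using D.hasCell_refl (D.y A)))

/-! ### From proarrows to relations. -/

lemma hasCell_relDouble (F : IsProperStableFactorizationSystem D.covers D.inclusions)
    {A B A' B' : C} {R : RelPro D.inclusions A B} {S : RelPro D.inclusions A' B'} {f : A ⟶ A'}
    {g : B ⟶ B'} (k : R.apex ⟶ S.apex) (hl : k ≫ S.l = R.l ≫ f) (hr : k ≫ S.r = R.r ≫ g) :
    (RelDouble F).HasCell R S f g :=
  ⟨⟨f, g, k, hl, hr⟩, rfl, rfl⟩

lemma hasCell_relOfPro (hD : D.IsRelational)
    (F : IsProperStableFactorizationSystem D.covers D.inclusions) {A B A' B' : C} {m : D.Pro A B}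
    {n : D.Pro A' B'} {f : A ⟶ A'} {g : B ⟶ B'} (h : D.HasCell m n f g) :
    (RelDouble F).HasCell (hD.relOfPro m) (hD.relOfPro n) f g := by
  obtain ⟨k, hl, hr⟩ := exists_spanMap (hD.tabulator m) (hD.isTabulator_tabulator n) h
  exact hasCell_relDouble F k hl hr

lemma hasCell_relOfPro_tens (hD : D.IsRelational)
    (F : IsProperStableFactorizationSystem D.covers D.inclusions) {A B E : C} (m : D.Pro A B)
    (n : D.Pro B E) :
    (RelDouble F).HasCell (F.relComp (hD.relOfPro m) (hD.relOfPro n))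
        (hD.relOfPro (D.tens m n)) (𝟙 A) (𝟙 E) ∧
      (RelDouble F).HasCell (hD.relOfPro (D.tens m n))
        (F.relComp (hD.relOfPro m) (hD.relOfPro n)) (𝟙 A) (𝟙 E) := by
  obtain ⟨i, hl, hr⟩ := hD.exists_relComp_iso F (hD.relOfPro m) (hD.relOfPro n)
    (hD.isTabulator_tabulator m) (hD.isTabulator_tabulator n) (hD.isTabulator_tabulator _)
    rfl rfl rfl rfl
  exact ⟨hasCell_relDouble F i.hom (by simp [hl]) (by simp [hr]),
    hasCell_relDouble F i.inv (by simp [← hl]) (by simp [← hr])⟩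

lemma hasCell_relOfPro_unit (hD : D.IsRelational)
    (F : IsProperStableFactorizationSystem D.covers D.inclusions) (A : C) :
    (RelDouble F).HasCell (F.relUnit A) (hD.relOfPro (D.y A)) (𝟙 A) (𝟙 A) ∧
      (RelDouble F).HasCell (hD.relOfPro (D.y A)) (F.relUnit A) (𝟙 A) (𝟙 A) := by
  obtain ⟨k, hl, hr⟩ := exists_lift (hD.isTabulator_tabulator (D.y A)) (D.hasCell_yMap (𝟙 A))
  exact ⟨hasCell_relDouble F k (by simpa using hl) (by simpa using hr),
    -- By unit-purity both legs of the tabulator of a unit are the same arrow, which is thus a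
    -- morphism of spans to the diagonal.
    hasCell_relDouble F (D.sMap (hD.tabulator (D.y A))) rfl
      (by simp [hD.unitPure.sMap_eq_tMap (hD.tabulator (D.y A))])⟩

/-- The double functor sending a proarrow to its tabulator. -/
noncomputable def proToRel (hD : D.IsRelational)
    (F : IsProperStableFactorizationSystem D.covers D.inclusions) :
    DoubleFunctor (𝟭 C) D (RelDouble F) :=
  F.isFlat_relDouble.functor (fun m => hD.relOfPro m) (hD.hasCell_relOfPro F)
    (fun m n => (hD.hasCell_relOfPro_tens F m n).1) (fun m n => (hD.hasCell_relOfPro_tens F m n).2)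
    (fun A => (hD.hasCell_relOfPro_unit F A).1) (fun A => (hD.hasCell_relOfPro_unit F A).2)

/-- Both relations tabulate the same proarrow, so its identity cell induces span morphisms in each
direction. -/
lemma hasCell_relOfPro_proOfRel (hD : D.IsRelational)
    (F : IsProperStableFactorizationSystem D.covers D.inclusions) {A B : C}
    (R : RelPro D.inclusions A B) :
    (RelDouble F).HasCell R (hD.relOfPro (hD.proOfRel R)) (𝟙 A) (𝟙 B) ∧
      (RelDouble F).HasCell (hD.relOfPro (hD.proOfRel R)) R (𝟙 A) (𝟙 B) := by
  obtain ⟨k, hl, hr⟩ := exists_spanMap (hD.tabulatorOfRel R)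
    (hD.isTabulator_tabulator (hD.proOfRel R)) (D.hasCell_refl _)
  obtain ⟨k', hl', hr'⟩ := exists_spanMap (hD.tabulator (hD.proOfRel R))
    (hD.isTabulator_tabulatorOfRel R) (D.hasCell_refl _)
  exact ⟨hasCell_relDouble F k (by simpa using hl) (by simpa using hr),
    hasCell_relDouble F k' (by simpa using hl') (by simpa using hr')⟩

/-- The double category is equivalent to the double category of relations. -/
noncomputable def relEquivalence (hD : D.IsRelational)
    (F : IsProperStableFactorizationSystem D.covers D.inclusions) :
    DoubleAdjointEquivalence (CategoryTheory.Equivalence.refl (C := C)) (RelDouble F) D :=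
  F.isFlat_relDouble.equivalence hD.isFlat (hD.relToPro F) (hD.proToRel F)
    (fun R => (hD.hasCell_relOfPro_proOfRel F R).1) (fun R => (hD.hasCell_relOfPro_proOfRel F R).2)
    -- The proarrow `m` and the one rebuilt from its relation have tabulators with the same apex and
    -- legs, so the identity of the apex gives both cells.
    (fun m => hD.hasCell_of_spanMap (hD.isTabulator_tabulatorOfRel (hD.relOfPro m))
      (hD.tabulator m) (𝟙 _) (by simp) (by simp))
    (fun m => hD.hasCell_of_spanMap (hD.isTabulator_tabulator m)
      (hD.tabulatorOfRel (hD.relOfPro m)) (𝟙 _) (by simp) (by simp))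

end DoubleCat.IsRelational

theorem mainTheorem2 {C : Type u} [Category.{v} C] (D : DoubleCat.{w, z} C)
    (unitPure : D.IsUnitPure) (cartesian : D.IsCartesian) (equipment : D.IsEquipment)
    (tabulators : D.HasTabulators) (strong : D.TabulatorsStrong)
    (discrete : D.TabulatorsDiscrete) (functorial : D.TabulatorsFunctorial)
    (relations : D.RelationsAreTabulators) (frobenius : D.Frobenius) :
    ∃ (_ : HasFiniteLimits C) (F : IsProperStableFactorizationSystem D.covers D.inclusions),
      Nonempty (DoubleAdjointEquivalence (CategoryTheory.Equivalence.refl (C := C))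
        (RelDouble F) D) := by
  have hD : D.IsRelational := ⟨unitPure, cartesian.hasTerminal, equipment, tabulators, strong,
    discrete, functorial, relations⟩
  have := hD.hasFiniteLimits
  exact ⟨this, hD.isProperStableFactorizationSystem, ⟨hD.relEquivalence _⟩⟩
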